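/- Let $m\ge 1$, $n\ge 0$ be integers, let $M=m-2n$ be the superdimension, assume $M>1$, and let $h>0$. Let $\mathfrak G_{2n}$ be the real Grassmann algebra with anticommuting generators $\theta_1,\dots,\theta_{2n}$, with left derivatives $\partial_{\theta_k}$ and Berezin integral $\int_B=\pi^{-n}\,\partial_{\theta_{2n}}\cdots\partial_{\theta_1}$. Put $$g(\mathbf x)=\sum_{j=1}^{m-1}x_j^2-x_m-\sum_{j=1}^n\theta_{2j-1}\theta_{2j}=g_0+\mathbf g,\qquad g_0(x)=\sum_{j=1}^{m-1}x_j^2-x_m,\quad \mathbf g=-\sum_{j=1}^n\theta_{2j-1}\theta_{2j}.$$ Let $\partial_{\mathbf x}=2\sum_{j=1}^n\bigl(\grave e_{2j}\partial_{\theta_{2j-1}}-\grave e_{2j-1}\partial_{\theta_{2j}}\bigr)-\sum_{j=1}^m e_j\partial_{x_j}$ be the super Dirac operator, where the Clifford generators satisfy $e_je_k+e_ke_j=-2\delta_{jk}$, $e_j\grave e_k+\grave e_ke_j=0$, $\grave e_j\grave e_k-\grave e_k\grave e_j=g_{jk}$, with $g_{2j-1,2j}=-g_{2j,2j-1}=1$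 and all other $g_{jk}=0$, and commute with the $x_j$ and $\theta_k$. A supervector $v=\sum_j v_je_j+\sum_k w_k\grave e_k$ ($v_j$ even, $w_k$ odd) has $v^2=-\sum_j v_j^2+\sum_j w_{2j-1}w_{2j}$, and $|v|=(-v^2)^{1/2}$. Here, for even $a=a_0+\mathbf a$ with body $a_0>0$ and nilpotent part $\mathbf a$, $a^p=\sum_{j=0}^n\frac{\mathbf a^j}{j!}\,p(p-1)\cdots(p-j+1)\,a_0^{p-j}$. The surface area of the super-paraboloid of revolution $SP^{m|2n}_h$ of height $h$ is $$\operatorname{area}(SP^{m|2n}_h)=\int_{\mathbb R^{m|2n}}\delta(g)\,|\partial_{\mathbf x}[g]|\,H(h-x_m)=\sum_{j=0}^n\frac1{j!}\int_{\mathbb R^m}\delta^{(j)}(g_0(x))\,H(h-x_m)\Bigl(\int_B\mathbf g^j\,|\partial_{\mathbf x}[g]|\Bigr)dx,$$ where $\delta(g)=\sum_{j=0}^n\frac{\mathbf g^j}{j!}\,\delta^{(j)}(g_0)$, $H$ is the Heaviside function, and $\delta^{(j)}(g_0)$ is the pull-back of the $j$-th derivative of the Dirac distribution, i.e. the limit of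 $\rho_i^{(j)}(g_0)$ along every sequence of smooth non-negative functions $\rho_i$ on $\mathbb R$ of integral one whose supports shrink to $0$. Then all these integrals exist, and $$\operatorname{area}(SP^{m|2n}_h)=\frac{\pi^{\frac{M-1}{2}}}{\Gamma\left(\frac{M+1}{2}\right)}\,h^{\frac{M-1}{2}}\;{}_2F_1\!\left(-\tfrac12,\tfrac{M-1}{2};\tfrac{M+1}{2};-4h\right),$$ where ${}_2F_1(a,b;c;z)$ is the Gauss hypergeometric function on $\mathbb C\setminus[1,\infty)$: the sum of the hypergeometric series for $|z|<1$ and its analytic continuation elsewhere. -/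

import Mathlib

open scoped Topology

namespace SuperSpace

/-! ### Grassmann algebra, fermionic derivatives, Berezin integral -/

/-- The real Grassmann algebra on `2n` anticommuting generators. -/
abbrev Grassmann (n : ℕ) : Type := ExteriorAlgebra ℝ (Fin (2 * n) → ℝ)

/-- The anticommuting variables, indexed by `0, …, 2n - 1`. -/
noncomputable def theta {n : ℕ} (k : Fin (2 * n)) : Grassmann n :=
  ExteriorAlgebra.ι ℝ (Pi.single k 1)

/-- The index `2j - 1` of the usual numbering `1, …, 2n` (here `j` and the indices start at `0`). -/
def oddIdx {n : ℕ} (j : Fin n) : Fin (2 * n) := ⟨2 * j.val, by omega⟩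

/-- The index `2j` of the usual numbering `1, …, 2n` (here `j` and the indices start at `0`). -/
def evenIdx {n : ℕ} (j : Fin n) : Fin (2 * n) := ⟨2 * j.val + 1, by omega⟩

/-- The left derivative with respect to the `k`-th fermionic variable: the linear map with
`∂ₖ 1 = 0` and `∂ₖ (θₗ w) = δₖₗ w - θₗ ∂ₖ w`. -/
noncomputable def fermionicDeriv {n : ℕ} (k : Fin (2 * n)) : Grassmann n →ₗ[ℝ] Grassmann n :=
  CliffordAlgebra.contractLeft (Q := (0 : QuadraticForm ℝ (Fin (2 * n) → ℝ)))
    (LinearMap.proj k : (Fin (2 * n) → ℝ) →ₗ[ℝ] ℝ)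

theorem fermionicDeriv_one {n : ℕ} (k : Fin (2 * n)) : fermionicDeriv k 1 = 0 :=
  CliffordAlgebra.contractLeft_one _ _

theorem fermionicDeriv_theta_mul {n : ℕ} (k l : Fin (2 * n)) (w : Grassmann n) :
    fermionicDeriv k (theta l * w) =
      (if k = l then w else 0) - theta l * fermionicDeriv k w := by
  have h := CliffordAlgebra.contractLeft_ι_mul
    (Q := (0 : QuadraticForm ℝ (Fin (2 * n) → ℝ)))
    (d := (LinearMap.proj k : (Fin (2 * n) → ℝ) →ₗ[ℝ] ℝ)) (Pi.single l 1) w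
  refine h.trans ?_
  by_cases hkl : k = l
  · subst hkl
    simp [theta, fermionicDeriv, ExteriorAlgebra.ι]
  · simp [theta, fermionicDeriv, ExteriorAlgebra.ι, hkl]

/-- The body (component of degree zero) of an element of the Grassmann algebra. -/
noncomputable def body {n : ℕ} (a : Grassmann n) : ℝ := ExteriorAlgebra.algebraMapInv a

/-- The nilpotent part of an element of the Grassmann algebra. -/
noncomputable def nilpotentPart {n : ℕ} (a : Grassmann n) : Grassmann n :=
  a - algebraMap ℝ (Grassmann n) (body a)

/-- The Berezin integral `π⁻ⁿ ∂_{2n} ⋯ ∂_1`; the iterated derivative is a scalar, read off by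
`body`. The first derivative that is applied is `∂_1`. -/
noncomputable def berezin {n : ℕ} (a : Grassmann n) : ℝ :=
  (Real.pi ^ n)⁻¹ * body ((List.finRange (2 * n)).foldl (fun w k => fermionicDeriv k w) a)

/-- Real powers of an even element `a` with positive body `a₀`, through the (finite) Taylor
expansion `∑ⱼ (𝐚ʲ / j!) (-1)ʲ (-p)ⱼ a₀^(p-j)`, with `(-p)ⱼ` the rising Pochhammer symbol. -/
noncomputable def grassmannRpow {n : ℕ} (a : Grassmann n) (p : ℝ) : Grassmann n :=
  ∑ j ∈ Finset.range (n + 1),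
    ((-1) ^ j * (ascPochhammer ℝ j).eval (-p) * body a ^ (p - j) / (j.factorial : ℝ)) •
      nilpotentPart a ^ j

/-! ### Superfunctions and the super Dirac operator -/

/-- Superfunctions `F(x, θ) = ∑_A F_A(x) θ_A` of `m` bosonic and `2n` fermionic variables. -/
abbrev SuperFunction (m n : ℕ) : Type := EuclideanSpace ℝ (Fin m) → Grassmann n

/-- The bosonic partial derivative `∂F/∂x_j = ∑_A (∂F_A/∂x_j) θ_A`. -/
noncomputable def bosonicDeriv {m n : ℕ} (j : Fin m) (F : SuperFunction m n) :
    SuperFunction m n := fun x =>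
  ∑ A : Finset (Fin (2 * n)),
    (fderiv ℝ (fun y => (Pi.basisFun ℝ (Fin (2 * n))).ExteriorAlgebra.repr (F y) A) x
      (EuclideanSpace.single j 1)) • (Pi.basisFun ℝ (Fin (2 * n))).ExteriorAlgebra A

/-- A supervector `∑ⱼ vⱼ eⱼ + ∑ₖ wₖ e`ₖ`, where `eⱼ` and `e`ₖ` are the orthogonal and the symplectic
Clifford generators, is given by its components `vⱼ` (even) and `wₖ` (odd). -/
structure SuperVector (m n : ℕ) where
  bosonic : Fin m → Grassmann n
  fermionic : Fin (2 * n) → Grassmann n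

/-- The square `-∑ⱼ vⱼ² + ∑ⱼ w_{2j-1} w_{2j}` of a supervector; see `SuperVector.sq_eq`. -/
noncomputable def SuperVector.sq {m n : ℕ} (v : SuperVector m n) : Grassmann n :=
  -∑ j, v.bosonic j ^ 2 + ∑ j : Fin n, v.fermionic (oddIdx j) * v.fermionic (evenIdx j)

/-- The absolute value `|v| = (-v²)^(1/2)` of a supervector. -/
noncomputable def SuperVector.abs {m n : ℕ} (v : SuperVector m n) : Grassmann n :=
  grassmannRpow (-v.sq) (1 / 2)

/-- The super-gradient `∂_𝐱[g]` of an even superfunction `g`, at the point `x`, where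
`∂_𝐱 = 2 ∑ⱼ (e`_{2j} ∂_{θ_{2j-1}} - e`_{2j-1} ∂_{θ_{2j}}) - ∑ⱼ eⱼ ∂_{xⱼ}`
is the super Dirac operator. -/
noncomputable def superGradient {m n : ℕ} (g : SuperFunction m n)
    (x : EuclideanSpace ℝ (Fin m)) : SuperVector m n where
  bosonic j := -bosonicDeriv j g x
  fermionic k :=
    if hk : k.val % 2 = 0 then
      -(2 : ℝ) • fermionicDeriv (⟨k.val + 1, by have := k.isLt; omega⟩ : Fin (2 * n)) (g x)
    else
      (2 : ℝ) • fermionicDeriv (⟨k.val - 1, by have := k.isLt; omega⟩ : Fin (2 * n)) (g x)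

/-- The symplectic form `g_{2j-1,2j} = -g_{2j,2j-1} = 1` (all other entries vanish). -/
def symplecticForm {n : ℕ} (k l : Fin (2 * n)) : ℝ :=
  if k.val % 2 = 0 ∧ l.val = k.val + 1 then 1
  else if l.val % 2 = 0 ∧ k.val = l.val + 1 then -1 else 0

theorem sum_symplecticForm {n : ℕ} {G : Type*} [AddCommGroup G] [Module ℝ G]
    (a : Fin (2 * n) → Fin (2 * n) → G) :
    ∑ k, ∑ l, symplecticForm k l • a k l =
      ∑ j : Fin n, (a (oddIdx j) (evenIdx j) - a (evenIdx j) (oddIdx j)) := by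
  have hsplit : ∀ f : Fin (2 * n) → G, ∑ k, f k = ∑ j : Fin n, (f (oddIdx j) + f (evenIdx j)) := by
    intro f
    rw [← Equiv.sum_comp ((finProdFinEquiv (m := n) (n := 2)).trans
      (finCongr (Nat.mul_comm n 2))) f, Fintype.sum_prod_type]
    refine Finset.sum_congr rfl fun j _ => ?_
    rw [Fin.sum_univ_two]
    congr 2
    · ext; simp [oddIdx]
    · ext; simp [evenIdx]; omega
  rw [hsplit]
  refine Finset.sum_congr rfl fun j _ => ?_
  rw [hsplit, hsplit, ← Finset.sum_add_distrib, Finset.sum_eq_single j]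
  · have h1 : symplecticForm (oddIdx j) (oddIdx j) = 0 := by
      unfold symplecticForm; rw [if_neg (by omega), if_neg (by omega)]
    have h2 : symplecticForm (evenIdx j) (evenIdx j) = 0 := by
      unfold symplecticForm; rw [if_neg (by omega), if_neg (by omega)]
    have h3 : symplecticForm (oddIdx j) (evenIdx j) = 1 := by
      unfold symplecticForm; rw [if_pos (by simp [oddIdx, evenIdx])]
    have h4 : symplecticForm (evenIdx j) (oddIdx j) = -1 := by
      unfold symplecticForm
      rw [if_neg (by simp [oddIdx, evenIdx]), if_pos (by simp [oddIdx, evenIdx])]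
    rw [h1, h2, h3, h4]
    simp [sub_eq_add_neg]
  · intro i _ hij
    have hij' : i.val ≠ j.val := fun h => hij (Fin.ext h)
    have h0 : ∀ k l : Fin (2 * n), k.val / 2 = j.val → l.val / 2 = i.val →
        symplecticForm k l = 0 := by
      intro k l hk hl
      unfold symplecticForm
      rw [if_neg (by omega), if_neg (by omega)]
    have ho : ∀ i : Fin n, (oddIdx i).val / 2 = i.val := fun i => by simp [oddIdx]
    have he : ∀ i : Fin n, (evenIdx i).val / 2 = i.val := fun i => by
      simp only [evenIdx]; omega
    simp [h0, ho, he]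
  · simp

/-- The formula for `SuperVector.sq` is the square in every algebra that contains the Grassmann
algebra and the Clifford generators, subject to the orthosymplectic Clifford relations. -/
theorem SuperVector.sq_eq {m n : ℕ} {B : Type*} [Ring B] [Algebra ℝ B]
    (φ : Grassmann n →ₐ[ℝ] B) (e : Fin m → B) (f : Fin (2 * n) → B)
    (heφ : ∀ j a, e j * φ a = φ a * e j) (hfφ : ∀ k a, f k * φ a = φ a * f k)
    (hee : ∀ j k, e j * e k + e k * e j = if j = k then -2 else 0)
    (hef : ∀ j k, e j * f k + f k * e j = 0)
    (hff : ∀ j k, f j * f k - f k * f j = algebraMap ℝ B (symplecticForm j k))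
    (v : SuperVector m n)
    (hvv : ∀ j k, v.bosonic j * v.bosonic k = v.bosonic k * v.bosonic j)
    (hvw : ∀ j k, v.bosonic j * v.fermionic k = v.fermionic k * v.bosonic j)
    (hww : ∀ j k, v.fermionic j * v.fermionic k = -(v.fermionic k * v.fermionic j)) :
    (∑ j, φ (v.bosonic j) * e j + ∑ k, φ (v.fermionic k) * f k) ^ 2 = φ v.sq := by
  set S := ∑ j, φ (v.bosonic j) * e j with hS
  set T := ∑ k, φ (v.fermionic k) * f k with hT
  have key : ∀ (a b : Grassmann n) (x y : B), x * φ b = φ b * x →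
      (φ a * x) * (φ b * y) = φ (a * b) * (x * y) := by
    intro a b x y hx
    rw [map_mul, mul_assoc, ← mul_assoc x, hx]; simp only [mul_assoc]
  have h2 : ∀ x y : B, (2 : ℝ) • x = (2 : ℝ) • y → x = y := fun x y h =>
    smul_right_injective B (two_ne_zero' ℝ) h
  have hSS : S * S = φ (-∑ j, v.bosonic j ^ 2) := by
    apply h2
    have h1 : S * S = ∑ j, ∑ k, φ (v.bosonic j * v.bosonic k) * (e j * e k) := by
      rw [hS, Finset.sum_mul_sum]
      exact Finset.sum_congr rfl fun j _ => Finset.sum_congr rfl fun k _ => key _ _ _ _ (heφ _ _)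
    have h1' : S * S = ∑ j, ∑ k, φ (v.bosonic j * v.bosonic k) * (e k * e j) := by
      rw [h1, Finset.sum_comm]
      exact Finset.sum_congr rfl fun j _ => Finset.sum_congr rfl fun k _ => by rw [hvv]
    rw [two_smul]
    nth_rewrite 1 [h1]
    rw [h1', ← Finset.sum_add_distrib]
    simp_rw [← Finset.sum_add_distrib, ← mul_add, hee]
    simp [pow_two, two_smul, Finset.sum_neg_distrib, mul_two, Finset.sum_add_distrib]
  have hTT : T * T = φ (∑ j : Fin n, v.fermionic (oddIdx j) * v.fermionic (evenIdx j)) := by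
    apply h2
    have h1 : T * T = ∑ j, ∑ k, φ (v.fermionic j * v.fermionic k) * (f j * f k) := by
      rw [hT, Finset.sum_mul_sum]
      exact Finset.sum_congr rfl fun j _ => Finset.sum_congr rfl fun k _ => key _ _ _ _ (hfφ _ _)
    have h1' : T * T = ∑ j, ∑ k, -(φ (v.fermionic j * v.fermionic k) * (f k * f j)) := by
      rw [h1, Finset.sum_comm]
      exact Finset.sum_congr rfl fun j _ => Finset.sum_congr rfl fun k _ => by
        rw [hww, map_neg, neg_mul]
    rw [two_smul]
    nth_rewrite 1 [h1]
    rw [h1', ← Finset.sum_add_distrib]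
    simp_rw [← Finset.sum_add_distrib, ← sub_eq_add_neg, ← mul_sub, hff]
    have h3 : ∀ j k : Fin (2 * n), φ (v.fermionic j * v.fermionic k) *
        algebraMap ℝ B (symplecticForm j k) =
        symplecticForm j k • φ (v.fermionic j * v.fermionic k) := by
      intro j k
      rw [Algebra.smul_def, Algebra.commutes]
    simp_rw [h3]
    rw [sum_symplecticForm, two_smul, ← map_add, ← Finset.sum_add_distrib, map_sum]
    refine Finset.sum_congr rfl fun j _ => ?_
    rw [hww (evenIdx j) (oddIdx j), map_neg, sub_neg_eq_add, map_add]
  have hST : S * T + T * S = 0 := by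
    rw [hS, hT, Finset.sum_mul_sum, Finset.sum_mul_sum, Finset.sum_comm, ← Finset.sum_add_distrib]
    refine Finset.sum_eq_zero fun k _ => ?_
    rw [← Finset.sum_add_distrib]
    refine Finset.sum_eq_zero fun j _ => ?_
    rw [key _ _ _ _ (heφ _ _), key _ _ _ _ (hfφ _ _), hvw, ← mul_add, hef, mul_zero]
  have : (S + T) ^ 2 = S * S + (S * T + T * S) + T * T := by
    rw [pow_two, mul_add, add_mul, add_mul]; abel
  rw [this, hST, hSS, hTT, add_zero, ← map_add, SuperVector.sq]

/-! ### The distributions `δ⁽ᵏ⁾(g₀)` and surface integrals -/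

/-- The Heaviside function. -/
noncomputable def heaviside (t : ℝ) : ℝ := if 0 ≤ t then 1 else 0

/-- A sequence of mollifiers on the line: smooth, non-negative, of total mass one, with supports
shrinking to the origin. -/
structure IsDeltaSequence (ρ : ℕ → ℝ → ℝ) : Prop where
  smooth : ∀ i, ContDiff ℝ (⊤ : ℕ∞) (ρ i)
  nonneg : ∀ i t, 0 ≤ ρ i t
  integral_eq_one : ∀ i, ∫ t, ρ i t = 1
  support_subset : ∀ r > 0, ∀ᶠ i in Filter.atTop, Function.support (ρ i) ⊆ Set.Ioo (-r) r

/-- `∫ δ⁽ᵏ⁾(g₀(x)) H(-g₁(x)) f(x) dV = L`. The pull-back `δ⁽ᵏ⁾(g₀)` is the limit of the functions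
`ρᵢ⁽ᵏ⁾(g₀)` along every sequence of mollifiers `ρᵢ → δ`. -/
def HasDeltaIntegral {m : ℕ} (k : ℕ) (g₀ g₁ f : EuclideanSpace ℝ (Fin m) → ℝ) (L : ℝ) : Prop :=
  ∀ ρ : ℕ → ℝ → ℝ, IsDeltaSequence ρ →
    Filter.Tendsto (fun i => ∫ x, iteratedDeriv k (ρ i) (g₀ x) * heaviside (-g₁ x) * f x)
      Filter.atTop (𝓝 L)

/-- The superdistribution integral
`∫_{ℝ^{m|2n}} δ(g) H(-g₁) F`, for an even superfunction `g = g₀ + 𝐠`, a real-valued function `g₁`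
and a superfunction `F`, exists and has the value `I`. Here `δ(g) = ∑_{j ≤ n} (𝐠ʲ / j!) δ⁽ʲ⁾(g₀)`,
and the integral over `ℝ^{m|2n}` is the bosonic integral of the Berezin integral. -/
def HasSuperDeltaIntegral {m n : ℕ} (g : SuperFunction m n) (g₁ : EuclideanSpace ℝ (Fin m) → ℝ)
    (F : SuperFunction m n) (I : ℝ) : Prop :=
  ∃ L : Fin (n + 1) → ℝ,
    (∀ j : Fin (n + 1), HasDeltaIntegral j (fun x => body (g x)) g₁
      (fun x => berezin (nilpotentPart (g x) ^ j.val * F x)) (L j)) ∧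
    I = ∑ j : Fin (n + 1), L j / (j.val.factorial : ℝ)

/-- The non-oriented integral of `F` over the part with `g₁ < 0` of the surface `g = 0`, that is
`∫_{ℝ^{m|2n}} δ(g) |∂_𝐱[g]| H(-g₁) F`, exists and has the value `I`. -/
def HasSurfaceIntegral {m n : ℕ} (g : SuperFunction m n) (g₁ : EuclideanSpace ℝ (Fin m) → ℝ)
    (F : SuperFunction m n) (I : ℝ) : Prop :=
  HasSuperDeltaIntegral g g₁ (fun x => (superGradient g x).abs * F x) I

theorem exists_isDeltaSequence : ∃ ρ : ℕ → ℝ → ℝ, IsDeltaSequence ρ := by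
  let b : ℕ → ContDiffBump (0 : ℝ) := fun i =>
    ⟨1 / (2 * ((i : ℝ) + 1)), 1 / ((i : ℝ) + 1), by positivity, by
      rw [div_lt_div_iff₀ (by positivity) (by positivity)]
      have : (0 : ℝ) ≤ i := Nat.cast_nonneg i
      nlinarith⟩
  refine ⟨fun i => (b i).normed MeasureTheory.volume, fun i => ?_, fun i t => ?_, fun i => ?_,
    fun r hr => ?_⟩
  · exact (b i).contDiff_normed
  · exact (b i).nonneg_normed t
  · exact (b i).integral_normed
  · have h := (tendsto_one_div_add_atTop_nhds_zero_nat (𝕜 := ℝ)).eventually (gt_mem_nhds hr)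
    filter_upwards [h] with i hi
    rw [(b i).support_normed_eq, Real.ball_eq_Ioo]
    simp only [zero_sub, zero_add]
    exact Set.Ioo_subset_Ioo (neg_le_neg hi.le) hi.le

theorem HasSurfaceIntegral.unique {m n : ℕ} {g : SuperFunction m n}
    {g₁ : EuclideanSpace ℝ (Fin m) → ℝ} {F : SuperFunction m n} {I J : ℝ}
    (hI : HasSurfaceIntegral g g₁ F I) (hJ : HasSurfaceIntegral g g₁ F J) : I = J := by
  obtain ⟨ρ, hρ⟩ := exists_isDeltaSequence
  obtain ⟨L, hL, rfl⟩ := hI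
  obtain ⟨K, hK, rfl⟩ := hJ
  refine Finset.sum_congr rfl fun j _ => ?_
  rw [tendsto_nhds_unique (hL j ρ hρ) (hK j ρ hρ)]

open Classical in
/-- The value of the surface integral (and `0` if it does not exist). -/
noncomputable def surfaceIntegral {m n : ℕ} (g : SuperFunction m n)
    (g₁ : EuclideanSpace ℝ (Fin m) → ℝ) (F : SuperFunction m n) : ℝ :=
  if h : ∃ I, HasSurfaceIntegral g g₁ F I then h.choose else 0

/-! ### The super-paraboloid of revolution -/

/-- The superdimension `M = m - 2n`. -/
def superdimension (m n : ℕ) : ℝ := (m : ℝ) - 2 * (n : ℝ)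

/-- The phase function `g(𝐱) = ∑_{j<m} xⱼ² - ∑ⱼ θ_{2j-1} θ_{2j} - x_m` of the super-paraboloid, in
`m = d + 1` bosonic variables. -/
noncomputable def paraboloidPhase (d n : ℕ) : SuperFunction (d + 1) n := fun x =>
  algebraMap ℝ (Grassmann n) (∑ j : Fin d, x j.castSucc ^ 2)
    - ∑ j : Fin n, theta (oddIdx j) * theta (evenIdx j)
    - algebraMap ℝ (Grassmann n) (x (Fin.last d))

/-- The real phase function `x_m - h` of the region `x_m < h`. -/
def heightPhase (d : ℕ) (h : ℝ) : EuclideanSpace ℝ (Fin (d + 1)) → ℝ := fun x =>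
  x (Fin.last d) - h

/-- The surface area of the super-paraboloid of height `h`, that is the integral of `1` over the
surface with characteristic function `δ(g) H(h - x_m)`. -/
noncomputable def paraboloidArea (d n : ℕ) (h : ℝ) : ℝ :=
  surfaceIntegral (paraboloidPhase d n) (heightPhase d h) (fun _ => 1)

/-! ### The Gauss hypergeometric function -/

/-- The complex plane cut along `[1, ∞)`. -/
def cutPlane : Set ℂ := {z | 1 - z ∈ Complex.slitPlane}

/-- `F` is the analytic continuation to the cut plane of the Gauss hypergeometric series. -/
def IsHypergeometricContinuation (a b c : ℂ) (F : ℂ → ℂ) : Prop :=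
  AnalyticOnNhd ℂ F cutPlane ∧ ∀ z : ℂ, ‖z‖ < 1 → F z = ordinaryHypergeometric a b c z

theorem IsHypergeometricContinuation.eqOn {a b c : ℂ} {F G : ℂ → ℂ}
    (hF : IsHypergeometricContinuation a b c F) (hG : IsHypergeometricContinuation a b c G) :
    Set.EqOn F G cutPlane := by
  have h0 : (0 : ℂ) ∈ cutPlane := by simp [cutPlane]
  have hconn : IsPreconnected cutPlane := by
    have h1 : IsPreconnected Complex.slitPlane :=
      (Complex.starConvex_one_slitPlane.isPathConnected Complex.one_mem_slitPlane).isConnected.isPreconnected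
    have h2 : cutPlane = (fun z : ℂ => 1 - z) '' Complex.slitPlane := by
      ext z
      constructor
      · intro hz
        exact ⟨1 - z, hz, by ring⟩
      · rintro ⟨w, hw, rfl⟩
        simpa [cutPlane] using hw
    rw [h2]
    exact h1.image _ (by fun_prop)
  refine hF.1.eqOn_of_preconnected_of_eventuallyEq hG.1 hconn h0 ?_
  filter_upwards [Metric.ball_mem_nhds (0 : ℂ) one_pos] with z hz
  have hz' : ‖z‖ < 1 := by simpa using hz
  rw [hF.2 z hz', hG.2 z hz']

open Classical in
/-- The Gauss hypergeometric function `₂F₁(a, b; c; z)` for `z` in the cut plane `ℂ \ [1, ∞)`: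
the sum of the hypergeometric series for `|z| < 1`, and its analytic continuation elsewhere. -/
noncomputable def gaussHypergeometric (a b c z : ℂ) : ℂ :=
  if h : ∃ F, IsHypergeometricContinuation a b c F then h.choose z else 0

end SuperSpace

namespace SuperSpace

variable {n : ℕ}

/-! ### Berezin integrals of powers of the symplectic form -/

/-! Write `Θ = ∑ θ_{2j-1} θ_{2j}`, `s = ∑_{j<m} xⱼ²`, `d = m - 1` and `f(s) = (1 + 4 s)^(1/2)`. Both
ingredients of the integrand depend on `s` and `Θ` only through `s - Θ`: the phase is `(s - Θ) -
x_m`, and the squared length of its super-gradient is `1 + 4 (s - Θ)`. So `|∂g|` is the Taylor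
expansion of `f` at `s` with increment `-Θ`. The Berezin integral only sees `Θⁿ`, with value `n! /
πⁿ` (`berezin_thetaTail_pow`). Hence the `j`-th density is a constant times `f^(n-j)(s) / (n-j)!`
(`berezin_density`), and with the factor `1 / j!` the constants become binomial coefficients.

For a fixed mollifier `ρ`, integrating `ρ^(j)(s - x_m) H(h - x_m)` over `x_m` gives `W_j(s - h)`,
where `W_j` is the `j`-th derivative of `W_0(u) = ∫_u^∞ ρ`. By Leibniz the sum over `j` is the
`n`-th derivative of `W_0(s - h) f(s)`. In polar coordinates this is integrated against `s^(d/2-1)`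
on `(0, ∞)`. Since `d > 2n`, which is the condition `M > 1`, `n` integrations by parts leave no
boundary terms and lower the weight to `s^(d/2-n-1)`, at the cost of `(-1)ⁿ Γ(d/2) / Γ(d/2-n)`
(`sum_choose_mul_integral_mollifierTail`). As `W_0(s - h)` tends to the indicator of `s < h`, the
limit is the classical area integral with `d` replaced by `M - 1`.

The definition also demands a limit for each `j` separately. For `j ≥ 1` the function `W_j(s - h)`
is concentrated near `h > 0`, where the integrand is smooth, so the limit exists
(`exists_tendsto_integral_mollifierTail`); its value is never needed. The remaining integral over
`[0, h]` is Euler's integral for `₂F₁(-1/2, b; b + 1; -4h)` with `b = (M - 1) / 2`. It is analytic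
on the whole cut plane and so equals the continuation for every `h`. -/

theorem theta_mul_self (k : Fin (2 * n)) : (theta k * theta k : Grassmann n) = 0 :=
  ExteriorAlgebra.ι_sq_zero _

theorem theta_mul_theta_comm (k l : Fin (2 * n)) :
    (theta k * theta l : Grassmann n) = -(theta l * theta k) := by
  have h := ExteriorAlgebra.ι_add_mul_swap (R := ℝ)
    (Pi.single k 1 : Fin (2 * n) → ℝ) (Pi.single l 1)
  exact eq_neg_of_add_eq_zero_left h

/-- The partial sum `∑_{j ≥ i} θ_{2j-1} θ_{2j}`. -/
noncomputable def thetaTail (n i : ℕ) : Grassmann n :=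
  ∑ j : Fin n, if i ≤ j.val then theta (oddIdx j) * theta (evenIdx j) else 0

/-- Passing a generator through a quadratic term costs two signs. -/
theorem commute_theta_thetaTail (k : Fin (2 * n)) (i : ℕ) :
    Commute (theta k) (thetaTail n i) := by
  refine Commute.sum_right _ _ _ fun j _ => ?_
  split_ifs
  · unfold Commute SemiconjBy
    rw [← mul_assoc, theta_mul_theta_comm k, neg_mul, mul_assoc, theta_mul_theta_comm k,
      mul_neg, neg_neg, mul_assoc]
  · exact Commute.zero_right _

theorem thetaTail_eq (i : Fin n) :
    thetaTail n i = theta (oddIdx i) * theta (evenIdx i) + thetaTail n (i + 1) := by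
  unfold thetaTail
  rw [← Finset.add_sum_erase _ _ (Finset.mem_univ i),
    ← Finset.add_sum_erase (a := i) (s := Finset.univ) (f := fun j : Fin n =>
      if i.val + 1 ≤ j.val then theta (oddIdx j) * theta (evenIdx j) else 0) (Finset.mem_univ i)]
  simp only [le_refl, if_true, Nat.not_succ_le_self, if_false, zero_add, add_right_inj]
  refine Finset.sum_congr rfl fun j hj => ?_
  have : j.val ≠ i.val := fun h => (Finset.ne_of_mem_erase hj) (Fin.ext h)
  simp only [show (i.val + 1 ≤ j.val) ↔ (i.val ≤ j.val) by omega]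

theorem thetaTail_self (n : ℕ) : thetaTail n n = 0 :=
  Finset.sum_eq_zero fun j _ => if_neg (by omega)

/-- The pair with index `i` is annihilated by its own factor `θ`, as generators square to zero. This
removes that pair after the first of the two derivatives has acted. -/
theorem theta_even_mul_thetaTail_pow (i : Fin n) (k : ℕ) :
    theta (evenIdx i) * thetaTail n i ^ k = theta (evenIdx i) * thetaTail n (i + 1) ^ k := by
  have h : theta (evenIdx i) * thetaTail n i = theta (evenIdx i) * thetaTail n (i + 1) := by
    rw [thetaTail_eq, mul_add, ← mul_assoc, theta_mul_theta_comm (evenIdx i), neg_mul, mul_assoc,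
      theta_mul_self, mul_zero, neg_zero, zero_add]
  induction k with
  | zero => simp
  | succ k ih =>
    rw [pow_succ', ← mul_assoc, h, (commute_theta_thetaTail (evenIdx i) (i + 1)).eq, mul_assoc, ih,
      ← mul_assoc, ← (commute_theta_thetaTail (evenIdx i) (i + 1)).eq, mul_assoc, ← pow_succ']

theorem fermionicDeriv_theta_mul_theta_mul (k a b : Fin (2 * n)) (w : Grassmann n) :
    fermionicDeriv k (theta a * theta b * w) =
      (if k = a then theta b * w else 0) - (if k = b then theta a * w else 0) +
        theta a * theta b * fermionicDeriv k w := by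
  rw [mul_assoc, fermionicDeriv_theta_mul, fermionicDeriv_theta_mul, mul_sub, mul_assoc,
    sub_sub_eq_add_sub, add_sub_right_comm]
  split_ifs <;> simp

/-- The tail contains only generators of index at least `2 i`, and it is even, so the derivative
passes through without a sign. -/
theorem fermionicDeriv_thetaTail_mul_of_lt {k : Fin (2 * n)} {i : ℕ} (hk : k.val < 2 * i)
    (w : Grassmann n) :
    fermionicDeriv k (thetaTail n i * w) = thetaTail n i * fermionicDeriv k w := by
  unfold thetaTail
  rw [Finset.sum_mul, Finset.sum_mul, map_sum]
  refine Finset.sum_congr rfl fun j _ => ?_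
  split_ifs with hj
  · have h1 : k ≠ oddIdx j := fun h => by rw [h] at hk; simp [oddIdx] at hk; omega
    have h2 : k ≠ evenIdx j := fun h => by rw [h] at hk; simp [evenIdx] at hk; omega
    rw [fermionicDeriv_theta_mul_theta_mul, if_neg h1, if_neg h2, sub_zero, zero_add]
  · simp

theorem fermionicDeriv_thetaTail_pow_of_lt {k : Fin (2 * n)} {i : ℕ} (hk : k.val < 2 * i)
    (l : ℕ) : fermionicDeriv k (thetaTail n i ^ l) = 0 := by
  induction l with
  | zero => rw [pow_zero, fermionicDeriv_one]
  | succ l ih => rw [pow_succ', fermionicDeriv_thetaTail_mul_of_lt hk, ih, mul_zero]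

theorem fermionicDeriv_thetaTail (i : Fin n) (w : Grassmann n) :
    fermionicDeriv (oddIdx i) (thetaTail n i * w) =
      theta (evenIdx i) * w + thetaTail n i * fermionicDeriv (oddIdx i) w := by
  have h1 : (oddIdx i : Fin (2 * n)) ≠ evenIdx i := fun h => by
    simp [oddIdx, evenIdx] at h
  rw [thetaTail_eq, add_mul, map_add, fermionicDeriv_theta_mul_theta_mul, if_pos rfl, if_neg h1,
    fermionicDeriv_thetaTail_mul_of_lt (by simp [oddIdx]), sub_zero, add_mul, add_assoc]

theorem fermionicDeriv_thetaTail_pow (i : Fin n) (l : ℕ) :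
    fermionicDeriv (oddIdx i) (thetaTail n i ^ l) =
      (l : ℝ) • (theta (evenIdx i) * thetaTail n (i + 1) ^ (l - 1)) := by
  rw [← theta_even_mul_thetaTail_pow]
  induction l with
  | zero => simp [fermionicDeriv_one]
  | succ l ih =>
    rw [pow_succ', fermionicDeriv_thetaTail, ih, mul_smul_comm, ← mul_assoc,
      ← (commute_theta_thetaTail (evenIdx i) i).eq, mul_assoc, ← pow_succ']
    rcases l with _ | l
    · simp
    · simp only [Nat.add_sub_cancel]
      push_cast
      module

theorem fermionicDeriv_pair_thetaTail_pow (i : Fin n) (l : ℕ) :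
    fermionicDeriv (evenIdx i) (fermionicDeriv (oddIdx i) (thetaTail n i ^ l)) =
      (l : ℝ) • thetaTail n (i + 1) ^ (l - 1) := by
  rw [fermionicDeriv_thetaTail_pow, map_smul, fermionicDeriv_theta_mul, if_pos rfl,
    fermionicDeriv_thetaTail_pow_of_lt (by simp [evenIdx]; omega), mul_zero, sub_zero]

/-- Each consecutive pair of derivatives consumes one pair of generators and lowers the power by
one; the exponents brought down multiply to a falling factorial. -/
theorem foldl_fermionicDeriv_take (l i : ℕ) (hi : i ≤ n) :
    ((List.finRange (2 * n)).take (2 * i)).foldl (fun w k => fermionicDeriv k w)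
      (thetaTail n 0 ^ l) = (l.descFactorial i : ℝ) • thetaTail n i ^ (l - i) := by
  induction i with
  | zero => simp
  | succ i ih =>
    have h1 : 2 * i < (List.finRange (2 * n)).length := by simp; omega
    have h2 : 2 * i + 1 < (List.finRange (2 * n)).length := by simp; omega
    rw [show 2 * (i + 1) = 2 * i + 1 + 1 by ring, List.take_succ_eq_append_getElem h2,
      List.take_succ_eq_append_getElem h1, List.foldl_append, List.foldl_append, ih (by omega)]
    have e1 : (List.finRange (2 * n))[2 * i] = oddIdx ⟨i, hi⟩ := by
      ext; simp [oddIdx]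
    have e2 : (List.finRange (2 * n))[2 * i + 1] = evenIdx ⟨i, hi⟩ := by
      ext; simp [evenIdx]
    simp only [List.foldl_cons, List.foldl_nil, e1, e2, map_smul]
    have := fermionicDeriv_pair_thetaTail_pow (⟨i, hi⟩ : Fin n) (l - i)
    simp only at this
    rw [this, smul_smul, Nat.descFactorial_succ, Nat.sub_sub]
    push_cast
    ring_nf

theorem berezin_smul (c : ℝ) (a : Grassmann n) : berezin (c • a) = c * berezin a := by
  have h : ∀ (l : List (Fin (2 * n))) (a : Grassmann n),
      l.foldl (fun w k => fermionicDeriv k w) (c • a) =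
        c • l.foldl (fun w k => fermionicDeriv k w) a := by
    intro l
    induction l with
    | nil => simp
    | cons k l ih => intro a; simp [ih]
  simp only [berezin, h, body, map_smul, smul_eq_mul]
  ring

theorem berezin_add (a b : Grassmann n) : berezin (a + b) = berezin a + berezin b := by
  have h : ∀ (l : List (Fin (2 * n))) (a b : Grassmann n),
      l.foldl (fun w k => fermionicDeriv k w) (a + b) =
        l.foldl (fun w k => fermionicDeriv k w) a + l.foldl (fun w k => fermionicDeriv k w) b := by
    intro l
    induction l with
    | nil => simp
    | cons k l ih => intro a; simp [ih]
  simp only [berezin, h, body, map_add]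
  ring

theorem berezin_sum {ι : Type*} (s : Finset ι) (f : ι → Grassmann n) :
    berezin (∑ i ∈ s, f i) = ∑ i ∈ s, berezin (f i) := by
  have h0 : berezin (0 : Grassmann n) = 0 := by
    simpa using berezin_smul (n := n) 0 0
  exact map_sum (⟨⟨berezin, h0⟩, berezin_add⟩ : Grassmann n →+ ℝ) f s

theorem body_algebraMap (c : ℝ) : body (algebraMap ℝ (Grassmann n) c) = c :=
  ExteriorAlgebra.algebraMap_leftInverse _ c

theorem berezin_thetaTail_pow (l : ℕ) :
    berezin (thetaTail n 0 ^ l) = if l = n then (n.factorial : ℝ) / Real.pi ^ n else 0 := by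
  have h := foldl_fermionicDeriv_take (n := n) l n le_rfl
  rw [List.take_of_length_le (by simp), thetaTail_self] at h
  rw [berezin, h]
  split_ifs with hl
  · rw [hl, Nat.sub_self, pow_zero, Nat.descFactorial_self, body, map_smul, map_one, smul_eq_mul]
    ring
  · rcases lt_or_gt_of_ne hl with h1 | h1
    -- Here `l - n` truncates to `0` and the power is `1`; the falling factorial is what vanishes.
    · rw [Nat.descFactorial_of_lt h1]
      simp [body]
    · rw [zero_pow (by omega)]
      simp [body]

/-! ### The density of the paraboloid -/

variable {d : ℕ}

theorem body_thetaTail (i : ℕ) : body (thetaTail n i) = 0 := by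
  simp only [body, thetaTail, map_sum]
  refine Finset.sum_eq_zero fun j _ => ?_
  split_ifs <;> simp [theta, ExteriorAlgebra.algebraMapInv]

theorem paraboloidPhase_eq (x : EuclideanSpace ℝ (Fin (d + 1))) :
    paraboloidPhase d n x =
      algebraMap ℝ (Grassmann n) (∑ j : Fin d, x j.castSucc ^ 2 - x (Fin.last d)) -
        thetaTail n 0 := by
  simp only [paraboloidPhase, thetaTail, Nat.zero_le, if_true, map_sub]
  abel

theorem body_paraboloidPhase (x : EuclideanSpace ℝ (Fin (d + 1))) :
    body (paraboloidPhase d n x) = ∑ j : Fin d, x j.castSucc ^ 2 - x (Fin.last d) := by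
  rw [paraboloidPhase_eq, body, map_sub, ← body, ← body, body_algebraMap, body_thetaTail, sub_zero]

theorem nilpotentPart_algebraMap_sub (c r : ℝ) (i : ℕ) :
    nilpotentPart (algebraMap ℝ (Grassmann n) c - r • thetaTail n i) = -(r • thetaTail n i) := by
  have : body (algebraMap ℝ (Grassmann n) c - r • thetaTail n i) = c := by
    rw [body, map_sub, map_smul, ← body, ← body, body_algebraMap, body_thetaTail, smul_zero,
      sub_zero]
  rw [nilpotentPart, this]
  abel

theorem nilpotentPart_paraboloidPhase (x : EuclideanSpace ℝ (Fin (d + 1))) :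
    nilpotentPart (paraboloidPhase d n x) = -thetaTail n 0 := by
  rw [paraboloidPhase_eq]
  have h := nilpotentPart_algebraMap_sub (n := n)
    (∑ j : Fin d, x j.castSucc ^ 2 - x (Fin.last d)) 1 0
  rwa [one_smul] at h

/-- Coordinatewise differentiation does not depend on the basis: the coordinates of `f y • u - a`
are affine in `f y`, and those of `u` reassemble to `u`. No knowledge of the monomial basis is
needed. -/
theorem sum_fderiv_repr_smul_basis {ι E A : Type*} [Fintype ι] [NormedAddCommGroup E]
    [NormedSpace ℝ E] [AddCommGroup A] [Module ℝ A] (B : Module.Basis ι ℝ A) (f : E → ℝ) (u a : A)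
    (x v : E) (hf : DifferentiableAt ℝ f x) :
    ∑ i, (fderiv ℝ (fun y => B.repr (f y • u - a) i) x v) • B i = (fderiv ℝ f x v) • u := by
  have h : ∀ i, fderiv ℝ (fun y => B.repr (f y • u - a) i) x v =
      fderiv ℝ f x v * B.repr u i := by
    intro i
    have h1 : (fun y => B.repr (f y • u - a) i) = fun y => f y * B.repr u i - B.repr a i := by
      funext y
      simp
    rw [h1, fderiv_sub_const, fderiv_mul_const hf]
    simp [mul_comm]
  simp_rw [h, mul_smul]
  rw [← Finset.smul_sum, B.sum_repr]

theorem bosonicDeriv_algebraMap_sub {m : ℕ} (j : Fin m) (f : EuclideanSpace ℝ (Fin m) → ℝ)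
    (a : Grassmann n) (x : EuclideanSpace ℝ (Fin m)) (hf : DifferentiableAt ℝ f x) :
    bosonicDeriv j (fun y => algebraMap ℝ (Grassmann n) (f y) - a) x =
      algebraMap ℝ (Grassmann n) (fderiv ℝ f x (EuclideanSpace.single j 1)) := by
  simp only [Algebra.algebraMap_eq_smul_one]
  have h := sum_fderiv_repr_smul_basis ((Pi.basisFun ℝ (Fin (2 * n))).ExteriorAlgebra) f 1 a x
    (EuclideanSpace.single j 1) hf
  unfold bosonicDeriv
  exact h

/-- The gradient of `∑_{j<m} xⱼ² - x_m`. -/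
noncomputable def paraboloidFDeriv (x : EuclideanSpace ℝ (Fin (d + 1))) :
    EuclideanSpace ℝ (Fin (d + 1)) →L[ℝ] ℝ :=
  ∑ j : Fin d, (2 * x j.castSucc) •
      (EuclideanSpace.proj j.castSucc : EuclideanSpace ℝ (Fin (d + 1)) →L[ℝ] ℝ) -
    (EuclideanSpace.proj (Fin.last d) : EuclideanSpace ℝ (Fin (d + 1)) →L[ℝ] ℝ)

theorem hasFDerivAt_paraboloid (x : EuclideanSpace ℝ (Fin (d + 1))) :
    HasFDerivAt (fun y : EuclideanSpace ℝ (Fin (d + 1)) =>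
      ∑ j : Fin d, y j.castSucc ^ 2 - y (Fin.last d)) (paraboloidFDeriv x) x := by
  refine HasFDerivAt.sub (HasFDerivAt.fun_sum fun j _ => ?_) ?_
  · have h := ((EuclideanSpace.proj j.castSucc :
      EuclideanSpace ℝ (Fin (d + 1)) →L[ℝ] ℝ).hasFDerivAt (x := x)).pow 2
    simpa using h
  · exact (EuclideanSpace.proj (Fin.last d) :
      EuclideanSpace ℝ (Fin (d + 1)) →L[ℝ] ℝ).hasFDerivAt

theorem superGradient_paraboloidPhase_bosonic (x : EuclideanSpace ℝ (Fin (d + 1)))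
    (j : Fin (d + 1)) : (superGradient (paraboloidPhase d n) x).bosonic j =
      algebraMap ℝ (Grassmann n)
        (Fin.lastCases (motive := fun _ => ℝ) 1 (fun i => -(2 * x i.castSucc)) j) := by
  have h0 : paraboloidPhase d n = fun y => algebraMap ℝ (Grassmann n)
      (∑ j : Fin d, y j.castSucc ^ 2 - y (Fin.last d)) - thetaTail n 0 :=
    funext paraboloidPhase_eq
  simp only [superGradient]
  rw [h0, bosonicDeriv_algebraMap_sub _ _ _ _ (hasFDerivAt_paraboloid x).differentiableAt,
    (hasFDerivAt_paraboloid x).fderiv, ← map_neg]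
  congr 1
  induction j using Fin.lastCases with
  | last => simp [paraboloidFDeriv, Fin.castSucc_ne_last]
  | cast i => simp [paraboloidFDeriv, Fin.castSucc_inj, Fin.castSucc_ne_last]

theorem fermionicDeriv_algebraMap_sub (k : Fin (2 * n)) (c : ℝ) (a : Grassmann n) :
    fermionicDeriv k (algebraMap ℝ (Grassmann n) c - a) = -fermionicDeriv k a := by
  rw [map_sub, Algebra.algebraMap_eq_smul_one, map_smul, fermionicDeriv_one, smul_zero, zero_sub]

theorem fermionicDeriv_thetaTail_zero (k : Fin (2 * n)) :
    fermionicDeriv k (thetaTail n 0) = ∑ j : Fin n,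
      ((if k = oddIdx j then theta (evenIdx j) else 0) -
        (if k = evenIdx j then theta (oddIdx j) else 0)) := by
  simp only [thetaTail, Nat.zero_le, if_true, map_sum]
  refine Finset.sum_congr rfl fun j _ => ?_
  simpa [fermionicDeriv_one] using fermionicDeriv_theta_mul_theta_mul k (oddIdx j) (evenIdx j) 1

theorem oddIdx_inj {i j : Fin n} : oddIdx i = oddIdx j ↔ i = j := by
  simp [oddIdx, Fin.ext_iff]

theorem evenIdx_inj {i j : Fin n} : evenIdx i = evenIdx j ↔ i = j := by
  simp [evenIdx, Fin.ext_iff]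

theorem oddIdx_ne_evenIdx (i j : Fin n) : oddIdx i ≠ evenIdx j := fun h => by
  simp [oddIdx, evenIdx] at h
  omega

theorem fermionicDeriv_paraboloidPhase_odd (x : EuclideanSpace ℝ (Fin (d + 1))) (i : Fin n) :
    fermionicDeriv (oddIdx i) (paraboloidPhase d n x) = -theta (evenIdx i) := by
  rw [paraboloidPhase_eq, fermionicDeriv_algebraMap_sub, fermionicDeriv_thetaTail_zero]
  simp [oddIdx_inj, oddIdx_ne_evenIdx]

theorem fermionicDeriv_paraboloidPhase_even (x : EuclideanSpace ℝ (Fin (d + 1))) (i : Fin n) :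
    fermionicDeriv (evenIdx i) (paraboloidPhase d n x) = theta (oddIdx i) := by
  rw [paraboloidPhase_eq, fermionicDeriv_algebraMap_sub, fermionicDeriv_thetaTail_zero]
  simp [evenIdx_inj, (oddIdx_ne_evenIdx _ _).symm]

theorem superGradient_paraboloidPhase_odd (x : EuclideanSpace ℝ (Fin (d + 1))) (i : Fin n) :
    (superGradient (paraboloidPhase d n) x).fermionic (oddIdx i) = -(2 : ℝ) • theta (oddIdx i) := by
  have h : (oddIdx i).val % 2 = 0 := by simp [oddIdx]
  simp only [superGradient, dif_pos h]
  rw [← fermionicDeriv_paraboloidPhase_even x i]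
  rfl

theorem superGradient_paraboloidPhase_even (x : EuclideanSpace ℝ (Fin (d + 1))) (i : Fin n) :
    (superGradient (paraboloidPhase d n) x).fermionic (evenIdx i) =
      -(2 : ℝ) • theta (evenIdx i) := by
  have h : ¬ (evenIdx i).val % 2 = 0 := by simp [evenIdx]
  simp only [superGradient, dif_neg h]
  rw [neg_smul, ← smul_neg, ← fermionicDeriv_paraboloidPhase_odd x i]
  rfl

/-- The fermionic components are `-2 θ`, so the squared length depends on `s - Θ` only, as does the
`x'`-part of the phase. -/
theorem neg_sq_superGradient_paraboloidPhase (x : EuclideanSpace ℝ (Fin (d + 1))) :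
    -(superGradient (paraboloidPhase d n) x).sq =
      algebraMap ℝ (Grassmann n) (1 + 4 * ∑ j : Fin d, x j.castSucc ^ 2) -
        (4 : ℝ) • thetaTail n 0 := by
  have h1 : ∑ j, (superGradient (paraboloidPhase d n) x).bosonic j ^ 2 =
      algebraMap ℝ (Grassmann n) (1 + 4 * ∑ j : Fin d, x j.castSucc ^ 2) := by
    simp_rw [superGradient_paraboloidPhase_bosonic, ← map_pow]
    rw [← map_sum, Fin.sum_univ_castSucc, Finset.mul_sum]
    congr 1
    simp only [Fin.lastCases_castSucc, Fin.lastCases_last]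
    rw [add_comm]
    congr 1
    · norm_num
    · exact Finset.sum_congr rfl fun j _ => by ring
  have h2 : ∑ j, (superGradient (paraboloidPhase d n) x).fermionic (oddIdx j) *
      (superGradient (paraboloidPhase d n) x).fermionic (evenIdx j) = (4 : ℝ) • thetaTail n 0 := by
    simp only [superGradient_paraboloidPhase_odd, superGradient_paraboloidPhase_even, thetaTail,
      Nat.zero_le, if_true, Finset.smul_sum, smul_mul_smul_comm]
    norm_num
  rw [SuperVector.sq, h1, h2]
  abel

/-- The `k`-th derivative of `s ↦ (1 + 4 s)^(1/2)`. -/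
noncomputable def densityDeriv (k : ℕ) (s : ℝ) : ℝ :=
  (-1) ^ k * (ascPochhammer ℝ k).eval (-(1 / 2)) * 4 ^ k * (1 + 4 * s) ^ ((1 / 2 : ℝ) - k)

/-- Only the total power `Θⁿ` survives, which selects the Taylor term of order `n - j`. The factors
`(-1)^j` and `(-4)^k` from the nilpotent parts combine to `(-1)^n 4^k`, and `4^k` belongs to the
derivative of `(1 + 4 s)^(1/2)`. -/
theorem berezin_density {j : ℕ} (hj : j ≤ n) (x : EuclideanSpace ℝ (Fin (d + 1))) :
    berezin (nilpotentPart (paraboloidPhase d n x) ^ j *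
      ((superGradient (paraboloidPhase d n) x).abs * 1)) =
    (-1) ^ n * (n.factorial : ℝ) / Real.pi ^ n * ((n - j).factorial : ℝ)⁻¹ *
      densityDeriv (n - j) (∑ i : Fin d, x i.castSucc ^ 2) := by
  have hb : body (algebraMap ℝ (Grassmann n) (1 + 4 * ∑ i : Fin d, x i.castSucc ^ 2) -
      (4 : ℝ) • thetaTail n 0) = 1 + 4 * ∑ i : Fin d, x i.castSucc ^ 2 := by
    rw [body, map_sub, map_smul, ← body, ← body, body_algebraMap, body_thetaTail, smul_zero,
      sub_zero]
  rw [mul_one, SuperVector.abs, neg_sq_superGradient_paraboloidPhase,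
    nilpotentPart_paraboloidPhase, grassmannRpow, nilpotentPart_algebraMap_sub, hb,
    Finset.mul_sum, berezin_sum]
  have h : ∀ k : ℕ, berezin ((-thetaTail n 0) ^ j *
      (((-1) ^ k * (ascPochhammer ℝ k).eval (-(1 / 2)) *
        (1 + 4 * ∑ i : Fin d, x i.castSucc ^ 2) ^ ((1 / 2 : ℝ) - k) / (k.factorial : ℝ)) •
        (-((4 : ℝ) • thetaTail n 0)) ^ k)) =
      if j + k = n then (-1) ^ n * (n.factorial : ℝ) / Real.pi ^ n * (k.factorial : ℝ)⁻¹ *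
        densityDeriv k (∑ i : Fin d, x i.castSucc ^ 2) else 0 := by
    intro k
    have e1 : (-thetaTail n 0) ^ j = ((-1 : ℝ) ^ j) • thetaTail n 0 ^ j := by
      rw [← smul_pow, neg_one_smul]
    have e2 : (-((4 : ℝ) • thetaTail n 0)) ^ k = ((-4 : ℝ) ^ k) • thetaTail n 0 ^ k := by
      rw [← smul_pow, neg_smul]
    rw [e1, e2, smul_smul, smul_mul_smul_comm, ← pow_add, berezin_smul, berezin_thetaTail_pow]
    split_ifs with hjk
    · rw [densityDeriv, ← hjk, neg_pow (4 : ℝ), pow_add (-1 : ℝ)]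
      ring
    · rw [mul_zero]
  rw [Finset.sum_congr rfl fun k _ => h k, Finset.sum_eq_single (n - j)]
  · rw [if_pos (by omega)]
  · intro k _ hk
    rw [if_neg (by omega)]
  · intro hk
    exact absurd (Finset.mem_range.2 (by omega)) hk

end SuperSpace

namespace SuperSpace

open MeasureTheory Set Function

/-! ### Integration of functions of `|x'|²` and `x_m` -/

/-- Polar coordinates followed by `s = r²`; the constant is half of `d` times the volume of the unit
ball. -/
theorem integral_comp_norm_sq {d : ℕ} (hd : 0 < d) (F : ℝ → ℝ) :
    ∫ y : EuclideanSpace ℝ (Fin d), F (‖y‖ ^ 2) =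
      Real.pi ^ ((d : ℝ) / 2) / Real.Gamma ((d : ℝ) / 2) *
        ∫ s in Ioi (0 : ℝ), s ^ ((d : ℝ) / 2 - 1) * F s := by
  have : Nonempty (Fin d) := ⟨⟨0, hd⟩⟩
  have : Nontrivial (EuclideanSpace ℝ (Fin d)) :=
    Module.nontrivial_of_finrank_pos (R := ℝ) (by simpa using hd)
  have hd' : (0 : ℝ) < (d : ℝ) / 2 := by positivity
  rw [integral_fun_norm_addHaar volume (fun r => F (r ^ 2)),
    ← integral_comp_rpow_Ioi_of_pos (g := fun s => s ^ ((d : ℝ) / 2 - 1) * F s) two_pos]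
  have h1 : ∫ x in Ioi (0 : ℝ), (2 * x ^ ((2 : ℝ) - 1)) •
      ((x ^ (2 : ℝ)) ^ ((d : ℝ) / 2 - 1) * F (x ^ (2 : ℝ))) =
      ∫ x in Ioi (0 : ℝ), 2 * (x ^ (d - 1) * F (x ^ 2)) := by
    refine setIntegral_congr_fun measurableSet_Ioi fun x hx => ?_
    have hx : 0 < x := hx
    have h2 : x ^ ((2 : ℝ) - 1) * (x ^ (2 : ℝ)) ^ ((d : ℝ) / 2 - 1) = x ^ (d - 1) := by
      rw [← Real.rpow_mul hx.le, ← Real.rpow_add hx, ← Real.rpow_natCast,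
        Nat.cast_sub (Nat.one_le_iff_ne_zero.2 hd.ne')]
      congr 1
      push_cast
      ring
    simp only [smul_eq_mul]
    rw [mul_assoc, ← mul_assoc (x ^ ((2 : ℝ) - 1)), h2, Real.rpow_two]
  rw [h1, integral_const_mul, Measure.real, EuclideanSpace.volume_ball]
  simp only [finrank_euclideanSpace, Fintype.card_fin, ENNReal.ofReal_one, one_pow, one_mul,
    smul_eq_mul, nsmul_eq_mul]
  rw [ENNReal.toReal_ofReal (by positivity), Real.Gamma_add_one hd'.ne', Real.sqrt_eq_rpow,
    ← Real.rpow_natCast, ← Real.rpow_mul Real.pi_pos.le]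
  have hG : Real.Gamma ((d : ℝ) / 2) ≠ 0 := (Real.Gamma_pos_of_pos hd').ne'
  have hd0 : (d : ℝ) ≠ 0 := by positivity
  rw [show (1 / 2 : ℝ) * d = d / 2 by ring]
  field_simp

theorem integral_comp_sum_sq {d : ℕ} (hd : 0 < d) (F : ℝ → ℝ) :
    ∫ y : Fin d → ℝ, F (∑ i, y i ^ 2) =
      Real.pi ^ ((d : ℝ) / 2) / Real.Gamma ((d : ℝ) / 2) *
        ∫ s in Ioi (0 : ℝ), s ^ ((d : ℝ) / 2 - 1) * F s := by
  rw [← integral_comp_norm_sq hd,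
    ← (EuclideanSpace.volume_preserving_symm_measurableEquiv_toLp (Fin d)).integral_comp'
      (fun y : Fin d → ℝ => F (∑ i, y i ^ 2))]
  refine integral_congr_ae (Filter.Eventually.of_forall fun y => ?_)
  simp [EuclideanSpace.norm_sq_eq]

theorem integral_euclidean_eq_integral_integral {d : ℕ} (f : ℝ → (Fin d → ℝ) → ℝ)
    (hf : Integrable (fun p : ℝ × (Fin d → ℝ) => f p.1 p.2)) :
    ∫ x : EuclideanSpace ℝ (Fin (d + 1)), f (x (Fin.last d)) (fun j => x j.castSucc) =
      ∫ y : Fin d → ℝ, ∫ t : ℝ, f t y := by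
  have h1 := (EuclideanSpace.volume_preserving_symm_measurableEquiv_toLp (Fin (d + 1))).integral_comp'
    (fun x : Fin (d + 1) → ℝ => f (x (Fin.last d)) (fun j => x j.castSucc))
  have h2 := (volume_preserving_piFinSuccAbove (fun _ : Fin (d + 1) => ℝ)
    (Fin.last d)).integral_comp' (fun p : ℝ × (Fin d → ℝ) => f p.1 p.2)
  have h3 : ∫ x : Fin (d + 1) → ℝ, f (x (Fin.last d)) (fun j => x j.castSucc) =
      ∫ p : ℝ × (Fin d → ℝ), f p.1 p.2 := by
    rw [← h2]
    refine integral_congr_ae (Filter.Eventually.of_forall fun y => ?_)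
    simp [MeasurableEquiv.piFinSuccAbove, Fin.init_def]
  refine Eq.trans ?_ (h3.trans (integral_prod_symm _ hf))
  rw [← h1]
  rfl

/-! ### The primitive of a mollifier and its derivatives -/

/-- The functions `u ↦ ∫_u^∞ ρ⁽ᵏ⁾`. -/
noncomputable def mollifierTail (ρ : ℝ → ℝ) : ℕ → ℝ → ℝ
  | 0, u => ∫ t in Ioi u, ρ t
  | k + 1, u => -iteratedDeriv k ρ u

variable {ρ : ℝ → ℝ} {r : ℝ}

theorem contDiff_iteratedDeriv_of_smooth (hs : ContDiff ℝ (⊤ : ℕ∞) ρ) (k : ℕ) :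
    ContDiff ℝ (⊤ : ℕ∞) (iteratedDeriv k ρ) := by
  rw [iteratedDeriv_eq_iterate]
  exact hs.iterate_deriv k

theorem iteratedDeriv_eq_zero_of_support (hr : support ρ ⊆ Ioo (-r) r) (k : ℕ) {u : ℝ}
    (hu : u ∉ Icc (-r) r) : iteratedDeriv k ρ u = 0 := by
  have h : ρ =ᶠ[𝓝 u] fun _ => 0 := by
    filter_upwards [isClosed_Icc.isOpen_compl.mem_nhds hu] with v hv
    by_contra hne
    exact hv (Ioo_subset_Icc_self (hr hne))
  rw [h.iteratedDeriv_eq]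
  simp

theorem tsupport_iteratedDeriv_subset (hr : support ρ ⊆ Ioo (-r) r) (k : ℕ) :
    tsupport (iteratedDeriv k ρ) ⊆ Icc (-r) r := by
  refine closure_minimal (fun u hu => ?_) isClosed_Icc
  by_contra h
  exact hu (iteratedDeriv_eq_zero_of_support hr k h)

theorem hasCompactSupport_iteratedDeriv (hr : support ρ ⊆ Ioo (-r) r) (k : ℕ) :
    HasCompactSupport (iteratedDeriv k ρ) :=
  isCompact_Icc.of_isClosed_subset (isClosed_tsupport _) (tsupport_iteratedDeriv_subset hr k)

theorem integral_Ioi_iteratedDeriv (hs : ContDiff ℝ (⊤ : ℕ∞) ρ) (hr : support ρ ⊆ Ioo (-r) r)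
    (k : ℕ) (u : ℝ) : ∫ t in Ioi u, iteratedDeriv k ρ t = mollifierTail ρ k u := by
  cases k with
  | zero => simp [mollifierTail, iteratedDeriv_zero]
  | succ k =>
    rw [iteratedDeriv_succ, mollifierTail]
    exact HasCompactSupport.integral_Ioi_deriv_eq
      ((contDiff_iteratedDeriv_of_smooth hs k).of_le (by exact_mod_cast le_top))
      (hasCompactSupport_iteratedDeriv hr k) u

/-- The tails form a chain of successive derivatives starting at `∫_u^∞ ρ`, which is the form
required by the Leibniz rule. -/
theorem hasDerivAt_mollifierTail (hs : ContDiff ℝ (⊤ : ℕ∞) ρ) (hr : support ρ ⊆ Ioo (-r) r)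
    (k : ℕ) (u : ℝ) : HasDerivAt (mollifierTail ρ k) (mollifierTail ρ (k + 1) u) u := by
  cases k with
  | zero =>
    have hint : Integrable ρ := hs.continuous.integrable_of_hasCompactSupport
      (by simpa [iteratedDeriv_zero] using hasCompactSupport_iteratedDeriv hr 0)
    have h0 : mollifierTail ρ 0 = fun u => mollifierTail ρ 0 0 - ∫ t in (0 : ℝ)..u, ρ t := by
      funext v
      have := intervalIntegral.integral_Ioi_sub_Ioi' (a := 0) (b := v) (μ := volume)
        (f := ρ) hint.integrableOn hint.integrableOn
      simp only [mollifierTail]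
      linarith
    rw [h0]
    simp only [mollifierTail, iteratedDeriv_zero]
    exact (intervalIntegral.integral_hasDerivAt_right (hs.continuous.intervalIntegrable _ _)
      hs.continuous.stronglyMeasurable.stronglyMeasurableAtFilter
      hs.continuous.continuousAt).const_sub _
  | succ k =>
    simp only [mollifierTail]
    have h := ((contDiff_iteratedDeriv_of_smooth hs k).differentiable (by simp) u).hasDerivAt.neg
    rw [iteratedDeriv_succ]
    exact h

theorem continuous_mollifierTail (hs : ContDiff ℝ (⊤ : ℕ∞) ρ) (hr : support ρ ⊆ Ioo (-r) r)
    (k : ℕ) : Continuous (mollifierTail ρ k) :=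
  continuous_iff_continuousAt.2 fun u => (hasDerivAt_mollifierTail hs hr k u).continuousAt

theorem mollifierTail_eq_zero (hr : support ρ ⊆ Ioo (-r) r) (k : ℕ) {u : ℝ} (hu : r < u) :
    mollifierTail ρ k u = 0 := by
  cases k with
  | zero =>
    refine setIntegral_eq_zero_of_forall_eq_zero fun t ht => ?_
    by_contra h
    exact absurd (hr h).2 (not_lt.2 (hu.le.trans (le_of_lt ht)))
  | succ k =>
    rw [mollifierTail, iteratedDeriv_eq_zero_of_support hr k fun h => absurd h.2 (not_le.2 hu),
      neg_zero]

theorem mollifierTail_zero_eq_one (h1 : ∫ t, ρ t = 1) (hr : support ρ ⊆ Ioo (-r) r) {u : ℝ}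
    (hu : u < -r) : mollifierTail ρ 0 u = 1 := by
  rw [mollifierTail, ← h1]
  refine setIntegral_eq_integral_of_forall_compl_eq_zero fun t ht => ?_
  by_contra h
  exact ht (hu.trans (hr h).1)

theorem abs_mollifierTail_zero_le (h0 : ∀ t, 0 ≤ ρ t) (h1 : ∫ t, ρ t = 1) (u : ℝ) :
    |mollifierTail ρ 0 u| ≤ 1 := by
  have hint : Integrable ρ := by
    by_contra h
    rw [integral_undef h] at h1
    exact zero_ne_one h1
  rw [mollifierTail, abs_of_nonneg (integral_nonneg h0), ← h1]
  exact setIntegral_le_integral hint (Filter.Eventually.of_forall h0)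

/-! ### Reduction of the delta integrals to one dimension -/

/-- With `u = s - t` the half-line `t ≤ h` becomes `u ≥ s - h`. -/
theorem integral_iteratedDeriv_mul_heaviside (hs : ContDiff ℝ (⊤ : ℕ∞) ρ)
    (hr : support ρ ⊆ Ioo (-r) r) (k : ℕ) (s h : ℝ) :
    ∫ t, iteratedDeriv k ρ (s - t) * heaviside (-(t - h)) = mollifierTail ρ k (s - h) := by
  have h1 : ∀ t, iteratedDeriv k ρ (s - t) * heaviside (-(t - h)) =
      (Ici (s - h)).indicator (iteratedDeriv k ρ) (s - t) := by
    intro t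
    unfold heaviside indicator
    simp only [mem_Ici]
    split_ifs with h2 h3 h3
    · rw [mul_one]
    · exact absurd h2 (by intro h4; apply h3; linarith)
    · exact absurd h3 (by intro h4; apply h2; linarith)
    · rw [mul_zero]
  simp_rw [h1]
  rw [integral_sub_left_eq_self (fun u => (Ici (s - h)).indicator (iteratedDeriv k ρ) u) volume s,
    integral_indicator measurableSet_Ici, integral_Ici_eq_integral_Ioi,
    integral_Ioi_iteratedDeriv hs hr]

/-- The integrand is bounded with bounded support: the mollifier forces `|s - t| ≤ r`, the Heaviside
factor forces `t ≤ h`, and `s ≥ 0`, so `-r ≤ t ≤ h` and `s ≤ h + r`. -/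
theorem integrable_delta_integrand {d : ℕ} (hs : ContDiff ℝ (⊤ : ℕ∞) ρ)
    (hr : support ρ ⊆ Ioo (-r) r) (k : ℕ) (h : ℝ) {φ : ℝ → ℝ} (hφm : Measurable φ)
    (hφ : ContinuousOn φ (Ici 0)) :
    Integrable (fun p : ℝ × (Fin d → ℝ) => iteratedDeriv k ρ (∑ i, p.2 i ^ 2 - p.1) *
      heaviside (-(p.1 - h)) * φ (∑ i, p.2 i ^ 2)) := by
  obtain ⟨C, hC⟩ := (hasCompactSupport_iteratedDeriv hr k).exists_bound_of_continuous
    (contDiff_iteratedDeriv_of_smooth hs k).continuous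
  obtain ⟨D, hD⟩ := (isCompact_Icc (a := 0) (b := h + r)).exists_bound_of_continuousOn
    (hφ.mono Icc_subset_Ici_self)
  -- The bound `h + r + 1` on the coordinates avoids a square root: `y² ≤ c` implies `|y| ≤ c + 1`.
  set K : Set (ℝ × (Fin d → ℝ)) :=
    Icc (-r) h ×ˢ Icc (fun _ => -(h + r + 1)) (fun _ => h + r + 1) with hK
  have hKc : IsCompact K := isCompact_Icc.prod isCompact_Icc
  have hsupp : ∀ p : ℝ × (Fin d → ℝ), iteratedDeriv k ρ (∑ i, p.2 i ^ 2 - p.1) *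
      heaviside (-(p.1 - h)) * φ (∑ i, p.2 i ^ 2) ≠ 0 →
      p ∈ K ∧ ∑ i, p.2 i ^ 2 ∈ Icc 0 (h + r) := by
    intro p hp
    have h1 : ∑ i, p.2 i ^ 2 - p.1 ∈ Icc (-r) r := by
      by_contra hn
      rw [iteratedDeriv_eq_zero_of_support hr k hn] at hp
      simp at hp
    have h2 : p.1 ≤ h := by
      by_contra hn
      rw [heaviside, if_neg (by linarith)] at hp
      simp at hp
    have h3 : 0 ≤ ∑ i, p.2 i ^ 2 := Finset.sum_nonneg fun i _ => sq_nonneg _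
    have h4 : ∀ i, p.2 i ^ 2 ≤ h + r := fun i =>
      (Finset.single_le_sum (fun i _ => sq_nonneg (p.2 i)) (Finset.mem_univ i)).trans
        (by linarith [h1.2])
    refine ⟨⟨⟨by linarith [h1.2], h2⟩, fun i => ?_, fun i => ?_⟩, h3, by linarith [h1.2]⟩
    · simp only
      nlinarith [h4 i, sq_nonneg (p.2 i)]
    · simp only
      nlinarith [h4 i, sq_nonneg (p.2 i)]
  have hmeas : Measurable (fun p : ℝ × (Fin d → ℝ) => iteratedDeriv k ρ (∑ i, p.2 i ^ 2 - p.1) *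
      heaviside (-(p.1 - h)) * φ (∑ i, p.2 i ^ 2)) := by
    have hH : Measurable heaviside :=
      Measurable.ite measurableSet_Ici measurable_const measurable_const
    have hρ := (contDiff_iteratedDeriv_of_smooth hs k).continuous.measurable
    have hsum : Measurable fun p : ℝ × (Fin d → ℝ) => ∑ i, p.2 i ^ 2 := by fun_prop
    exact ((hρ.comp (hsum.sub measurable_fst)).mul
      (hH.comp (measurable_fst.sub_const h).neg)).mul (hφm.comp hsum)
  rw [← integrableOn_iff_integrable_of_support_subset (s := K) fun p hp => (hsupp p hp).1]
  refine Measure.integrableOn_of_bounded (M := |C| * 1 * |D|) hKc.measure_lt_top.ne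
    hmeas.aestronglyMeasurable (Filter.Eventually.of_forall fun p => ?_)
  by_cases hp : iteratedDeriv k ρ (∑ i, p.2 i ^ 2 - p.1) *
      heaviside (-(p.1 - h)) * φ (∑ i, p.2 i ^ 2) = 0
  · rw [hp, norm_zero]
    positivity
  · rw [norm_mul, norm_mul]
    refine mul_le_mul (mul_le_mul ((hC _).trans (le_abs_self _)) ?_ (norm_nonneg _) (abs_nonneg _))
      ((hD _ (hsupp p hp).2).trans (le_abs_self _)) (norm_nonneg _) (by positivity)
    unfold heaviside
    split_ifs <;> simp

theorem integral_delta_eq {d : ℕ} (hd : 0 < d) (hs : ContDiff ℝ (⊤ : ℕ∞) ρ)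
    (hr : support ρ ⊆ Ioo (-r) r) (k : ℕ) (h : ℝ) {φ : ℝ → ℝ} (hφm : Measurable φ)
    (hφ : ContinuousOn φ (Ici 0)) :
    ∫ x : EuclideanSpace ℝ (Fin (d + 1)),
        iteratedDeriv k ρ (∑ j : Fin d, x j.castSucc ^ 2 - x (Fin.last d)) *
          heaviside (-heightPhase d h x) * φ (∑ j : Fin d, x j.castSucc ^ 2) =
      Real.pi ^ ((d : ℝ) / 2) / Real.Gamma ((d : ℝ) / 2) *
        ∫ s in Ioi (0 : ℝ), s ^ ((d : ℝ) / 2 - 1) * (φ s * mollifierTail ρ k (s - h)) := by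
  have h1 := integral_euclidean_eq_integral_integral (d := d)
    (fun t y => iteratedDeriv k ρ (∑ i, y i ^ 2 - t) * heaviside (-(t - h)) * φ (∑ i, y i ^ 2))
    (integrable_delta_integrand hs hr k h hφm hφ)
  refine h1.trans ?_
  simp_rw [integral_mul_const, integral_iteratedDeriv_mul_heaviside hs hr]
  rw [← integral_comp_sum_sq hd (fun s => φ s * mollifierTail ρ k (s - h))]
  simp_rw [mul_comm]

end SuperSpace

namespace SuperSpace

/-! ### Euler's integral for the hypergeometric function -/

theorem hasSum_one_sub_cpow_neg (a : ℂ) {z : ℂ} (hz : ‖z‖ < 1) :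
    HasSum (fun k : ℕ => ((k.factorial : ℂ)⁻¹ * (ascPochhammer ℂ k).eval a) * z ^ k)
      ((1 - z) ^ (-a)) := by
  have h := (Complex.one_add_cpow_hasFPowerSeriesOnBall_zero (a := -a)).hasSum
    (y := -z) (by simpa [← ENNReal.ofReal_one, Metric.eball_ofReal] using hz)
  -- The second and third parameters cancel, so their common value is free; `1` makes the Pochhammer
  -- symbol a factorial, hence nonzero.
  rw [binomialSeries_eq_ordinaryHypergeometricSeries (b := 1)
    (fun k => by norm_cast)] at h
  rw [zero_add, neg_neg, ← sub_eq_add_neg] at h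
  convert! h using 2 with k
  have h1 : (ascPochhammer ℂ k).eval 1 ≠ 0 := by
    simp [ascPochhammer_eval_one, Nat.factorial_ne_zero]
  have h2 : ((ordinaryHypergeometricSeries ℂ a 1 1).compContinuousLinearMap
      (-(ContinuousLinearMap.id ℂ ℂ)) k) (fun _ => -z) =
      (ordinaryHypergeometricSeries ℂ a 1 1 k) (fun _ => z) := by
    rw [FormalMultilinearSeries.compContinuousLinearMap_apply]
    congr 1
    ext i
    simp
  rw [h2, ordinaryHypergeometricSeries_apply_eq, mul_inv_cancel_right₀ h1, smul_eq_mul]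

/-- Euler's integral for `₂F₁(a, b; b + 1; z)`. -/
noncomputable def eulerIntegral (a : ℂ) (b : ℝ) (z : ℂ) : ℂ :=
  b * ∫ t in (0 : ℝ)..1, ((t ^ (b - 1) : ℝ) : ℂ) * (1 - z * t) ^ (-a)

/-- `1 - z t` lies on the segment from `1` to `1 - z`, and the slit plane is star-shaped about `1`.
-/
theorem one_sub_mul_mem_slitPlane {z : ℂ} (hz : z ∈ cutPlane) {t : ℝ} (h0 : 0 ≤ t) (h1 : t ≤ 1) :
    1 - z * t ∈ Complex.slitPlane := by
  have h := Complex.starConvex_one_slitPlane hz (sub_nonneg.2 h1) h0 (by ring)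
  convert h using 1
  simp only [Complex.real_smul]
  push_cast
  ring

theorem isOpen_cutPlane : IsOpen cutPlane :=
  Complex.isOpen_slitPlane.preimage (by fun_prop : Continuous fun z : ℂ => 1 - z)

theorem intervalIntegrable_ofReal_rpow {b : ℝ} (hb : 0 < b) :
    IntervalIntegrable (fun t : ℝ => ((t ^ (b - 1) : ℝ) : ℂ)) MeasureTheory.volume 0 1 := by
  have h : IntervalIntegrable (fun t : ℝ => t ^ (b - 1)) MeasureTheory.volume 0 1 :=
    intervalIntegral.intervalIntegrable_rpow' (by linarith)
  rw [intervalIntegrable_iff] at h ⊢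
  exact h.ofReal

/-- Differentiation under the integral sign: the power of `1 - w t` in the derivative is bounded on
the compact set `closedBall z r × [0, 1]`, and the weight `t^(b-1)` is integrable because `b > 0`.
-/
theorem analyticOnNhd_eulerIntegral (a : ℂ) {b : ℝ} (hb : 0 < b) :
    AnalyticOnNhd ℂ (eulerIntegral a b) cutPlane := by
  refine DifferentiableOn.analyticOnNhd (fun z hz => ?_) isOpen_cutPlane
  refine DifferentiableAt.differentiableWithinAt ?_
  refine DifferentiableAt.const_mul ?_ _
  obtain ⟨r, hr, hrs⟩ := Metric.nhds_basis_closedBall.mem_iff.1 (isOpen_cutPlane.mem_nhds hz)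
  have hcont : ∀ c : ℂ, ContinuousOn (fun p : ℂ × ℝ => (1 - p.1 * p.2) ^ c)
      (Metric.closedBall z r ×ˢ Set.Icc 0 1) := by
    intro c
    refine ContinuousOn.cpow (by fun_prop) continuousOn_const fun p hp => ?_
    exact one_sub_mul_mem_slitPlane (hrs hp.1) hp.2.1 hp.2.2
  have hslice : ∀ c : ℂ, ∀ w ∈ Metric.closedBall z r,
      ContinuousOn (fun t : ℝ => (1 - w * t) ^ c) (Set.Icc 0 1) := by
    intro c w hw
    exact (hcont c).comp (f := fun t : ℝ => (w, t)) (by fun_prop) fun t ht => ⟨hw, ht⟩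
  have hII : ∀ c : ℂ, ∀ w ∈ Metric.closedBall z r, IntervalIntegrable
      (fun t : ℝ => ((t ^ (b - 1) : ℝ) : ℂ) * (1 - w * t) ^ c) MeasureTheory.volume 0 1 := by
    intro c w hw
    refine (intervalIntegrable_ofReal_rpow hb).mul_continuousOn ?_
    rw [Set.uIcc_of_le zero_le_one]
    exact hslice c w hw
  obtain ⟨C, hC⟩ := ((isCompact_closedBall z r).prod isCompact_Icc).exists_bound_of_continuousOn
    (hcont (-a - 1))
  have hz' : z ∈ Metric.closedBall z r := Metric.mem_closedBall_self hr.le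
  refine (intervalIntegral.hasDerivAt_integral_of_dominated_loc_of_deriv_le
    (F' := fun w t => ((t ^ (b - 1) : ℝ) : ℂ) * (((-a) * (1 - w * t) ^ (-a - 1)) * (-t)))
    (bound := fun t => t ^ (b - 1) * (‖a‖ * C))
    (Metric.closedBall_mem_nhds z hr) ?_ (hII _ z hz') ?_ ?_ ?_ ?_).2.differentiableAt
  · filter_upwards [Metric.closedBall_mem_nhds z hr] with w hw
    have := (hII (-a) w hw).aestronglyMeasurable
    rwa [Set.uIoc_of_le zero_le_one]
  · have : IntervalIntegrable (fun t : ℝ => ((t ^ (b - 1) : ℝ) : ℂ) *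
        (((-a) * (1 - z * t) ^ (-a - 1)) * (-t))) MeasureTheory.volume 0 1 := by
      refine (intervalIntegrable_ofReal_rpow hb).mul_continuousOn ?_
      rw [Set.uIcc_of_le zero_le_one]
      exact (continuousOn_const.mul (hslice _ z hz')).mul (by fun_prop)
    have := this.aestronglyMeasurable
    rwa [Set.uIoc_of_le zero_le_one]
  · refine Filter.Eventually.of_forall fun t ht w hw => ?_
    rw [Set.uIoc_of_le zero_le_one] at ht
    have hCw := hC (w, t) ⟨hw, ht.1.le, ht.2⟩
    simp only at hCw
    rw [norm_mul, norm_mul, norm_mul, norm_neg, norm_neg, Complex.norm_real, Complex.norm_real,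
      Real.norm_of_nonneg (Real.rpow_nonneg ht.1.le _), Real.norm_of_nonneg ht.1.le]
    refine mul_le_mul_of_nonneg_left ?_ (Real.rpow_nonneg ht.1.le _)
    calc ‖a‖ * ‖(1 - w * t) ^ (-a - 1)‖ * t ≤ ‖a‖ * ‖(1 - w * t) ^ (-a - 1)‖ * 1 :=
          mul_le_mul_of_nonneg_left ht.2 (by positivity)
      _ ≤ ‖a‖ * C := by rw [mul_one]; exact mul_le_mul_of_nonneg_left hCw (norm_nonneg _)
  · exact (intervalIntegral.intervalIntegrable_rpow' (by linarith)).mul_const _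
  · refine Filter.Eventually.of_forall fun t ht w hw => ?_
    rw [Set.uIoc_of_le zero_le_one] at ht
    refine HasDerivAt.const_mul _ ?_
    refine HasDerivAt.cpow_const ?_ (one_sub_mul_mem_slitPlane (hrs hw) ht.1.le ht.2)
    simpa using ((hasDerivAt_id w).mul_const (t : ℂ)).const_sub 1

/-- Both `(b)_k (b + k)` and `b (b + 1)_k` equal `(b)_{k+1}`. -/
theorem ascPochhammer_eval_div_add_one {b : ℝ} (hb : 0 < b) (k : ℕ) :
    (ascPochhammer ℂ k).eval (b : ℂ) * ((ascPochhammer ℂ k).eval (b + 1 : ℂ))⁻¹ = b / (b + k) := by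
  have hne : ∀ j : ℕ, (b : ℂ) + j ≠ 0 := fun j => by
    have : (0 : ℝ) < b + j := by positivity
    exact_mod_cast this.ne'
  have hpos : (ascPochhammer ℂ k).eval (b + 1 : ℂ) ≠ 0 := by
    have h := ascPochhammer_pos k (b + 1) (by linarith)
    have h2 : (ascPochhammer ℂ k).eval (b + 1 : ℂ) = ((ascPochhammer ℝ k).eval (b + 1) : ℝ) := by
      have := ascPochhammer_eval₂ Complex.ofRealHom k (b + 1)
      have h3 := Polynomial.eval₂_at_apply (p := ascPochhammer ℝ k) Complex.ofRealHom (b + 1)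
      simp only [Complex.ofRealHom_eq_coe, Complex.ofReal_add, Complex.ofReal_one] at this h3
      rw [this, h3]
    rw [h2]
    exact_mod_cast h.ne'
  rw [← div_eq_mul_inv, div_eq_div_iff hpos (hne k)]
  have h1 := ascPochhammer_succ_eval (S := ℂ) k (b : ℂ)
  have h2 : (ascPochhammer ℂ (k + 1)).eval (b : ℂ) = b * (ascPochhammer ℂ k).eval (b + 1 : ℂ) := by
    rw [ascPochhammer_succ_left]
    simp
  rw [← h1, h2]

/-- Integrate the binomial series of `(1 - z t)^(-a)` termwise. Since `∫ t^(b-1+k) = 1 / (b + k)`,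
the factor `b / (b + k)` is the quotient `(b)_k / (b + 1)_k`. -/
theorem eulerIntegral_eq_ordinaryHypergeometric (a : ℂ) {b : ℝ} (hb : 0 < b) {z : ℂ}
    (hz : ‖z‖ < 1) : eulerIntegral a b z = ordinaryHypergeometric a (b : ℂ) ((b + 1 : ℝ) : ℂ) z := by
  set c : ℕ → ℂ := fun k => (k.factorial : ℂ)⁻¹ * (ascPochhammer ℂ k).eval a with hc
  have hsum : Summable fun k => ‖c k * z ^ k‖ := (hasSum_one_sub_cpow_neg a hz).summable.norm
  have hpow : ∀ k : ℕ, ∫ t in (0 : ℝ)..1, ((t ^ (b - 1) : ℝ) : ℂ) * (c k * (z * t) ^ k) =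
      c k * z ^ k * (1 / (b + k)) := by
    intro k
    have h1 : ∫ t in (0 : ℝ)..1, ((t ^ (b - 1) : ℝ) : ℂ) * (c k * (z * t) ^ k) =
        ∫ t in (0 : ℝ)..1, (c k * z ^ k) * ((t ^ (b - 1 + k) : ℝ) : ℂ) := by
      refine intervalIntegral.integral_congr_ae (Filter.Eventually.of_forall fun t ht => ?_)
      rw [Set.uIoc_of_le zero_le_one] at ht
      rw [Real.rpow_add ht.1, Real.rpow_natCast]
      push_cast
      ring
    rw [h1, intervalIntegral.integral_const_mul, intervalIntegral.integral_ofReal,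
      integral_rpow (Or.inl (by have : (0 : ℝ) ≤ k := k.cast_nonneg; linarith))]
    have hk : b - 1 + k + 1 = b + k := by ring
    have hk0 : b + k ≠ 0 := by positivity
    rw [hk, Real.one_rpow, Real.zero_rpow hk0]
    push_cast
    ring
  have hS := intervalIntegral.hasSum_integral_of_dominated_convergence
    (μ := MeasureTheory.volume) (a := 0) (b := 1)
    (F := fun (k : ℕ) (t : ℝ) => ((t ^ (b - 1) : ℝ) : ℂ) * (c k * (z * t) ^ k))
    (f := fun t : ℝ => ((t ^ (b - 1) : ℝ) : ℂ) * (1 - z * t) ^ (-a))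
    (fun k t => t ^ (b - 1) * ‖c k * z ^ k‖) ?_ ?_ ?_ ?_ ?_
  · simp_rw [hpow] at hS
    rw [eulerIntegral, ← hS.tsum_eq, ordinaryHypergeometric_eq_tsum, ← tsum_mul_left]
    refine tsum_congr fun k => ?_
    have h := ascPochhammer_eval_div_add_one hb k
    rw [smul_eq_mul]
    push_cast
    calc _ = c k * (b / (b + k)) * z ^ k := by ring
      _ = _ := by rw [← h]; simp only [hc]; ring
  · intro k
    have h : IntervalIntegrable (fun t : ℝ => ((t ^ (b - 1) : ℝ) : ℂ) * (c k * (z * t) ^ k))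
        MeasureTheory.volume 0 1 :=
      (intervalIntegrable_ofReal_rpow hb).mul_continuousOn (by fun_prop)
    rw [Set.uIoc_of_le zero_le_one]
    exact h.aestronglyMeasurable
  · refine fun k => Filter.Eventually.of_forall fun t ht => ?_
    rw [Set.uIoc_of_le zero_le_one] at ht
    rw [norm_mul, Complex.norm_real, Real.norm_of_nonneg (Real.rpow_nonneg ht.1.le _)]
    refine mul_le_mul_of_nonneg_left ?_ (Real.rpow_nonneg ht.1.le _)
    rw [norm_mul (c k), norm_mul (c k)]
    refine mul_le_mul_of_nonneg_left ?_ (norm_nonneg _)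
    rw [norm_pow, norm_pow, norm_mul, Complex.norm_real, Real.norm_of_nonneg ht.1.le]
    exact pow_le_pow_left₀ (mul_nonneg (norm_nonneg _) ht.1.le)
      (mul_le_of_le_one_right (norm_nonneg _) ht.2) k
  · exact Filter.Eventually.of_forall fun t _ => hsum.mul_left _
  · simp_rw [tsum_mul_left]
    exact (intervalIntegral.intervalIntegrable_rpow' (by linarith)).mul_const _
  · refine Filter.Eventually.of_forall fun t ht => ?_
    rw [Set.uIoc_of_le zero_le_one] at ht
    refine (hasSum_one_sub_cpow_neg a ?_).mul_left _
    rw [norm_mul, Complex.norm_real, Real.norm_of_nonneg ht.1.le]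
    exact (mul_le_of_le_one_right (norm_nonneg _) ht.2).trans_lt hz

theorem isHypergeometricContinuation_eulerIntegral (a : ℂ) {b : ℝ} (hb : 0 < b) :
    IsHypergeometricContinuation a b ((b + 1 : ℝ) : ℂ) (eulerIntegral a b) :=
  ⟨analyticOnNhd_eulerIntegral a hb, fun _ hz => eulerIntegral_eq_ordinaryHypergeometric a hb hz⟩

theorem gaussHypergeometric_eq_eulerIntegral (a : ℂ) {b : ℝ} (hb : 0 < b) {z : ℂ}
    (hz : z ∈ cutPlane) :
    gaussHypergeometric a b ((b + 1 : ℝ) : ℂ) z = eulerIntegral a b z := by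
  have h : ∃ F, IsHypergeometricContinuation a b ((b + 1 : ℝ) : ℂ) F :=
    ⟨_, isHypergeometricContinuation_eulerIntegral a hb⟩
  rw [gaussHypergeometric, dif_pos h]
  exact h.choose_spec.eqOn (isHypergeometricContinuation_eulerIntegral a hb) hz

/-- The real form of `₂F₁(-1/2, b; b + 1; -4h)`, scaled to the interval `[0, h]`. -/
theorem rpow_mul_gaussHypergeometric {b h : ℝ} (hb : 0 < b) (hh : 0 < h) :
    ((h ^ b : ℝ) : ℂ) * gaussHypergeometric (-1 / 2) b ((b + 1 : ℝ) : ℂ) ((-4 * h : ℝ) : ℂ) =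
      ((b * ∫ s in (0 : ℝ)..h, s ^ (b - 1) * (1 + 4 * s) ^ (1 / 2 : ℝ) : ℝ) : ℂ) := by
  have hz : ((-4 * h : ℝ) : ℂ) ∈ cutPlane := by
    refine Or.inl ?_
    have : (1 - ((-4 * h : ℝ) : ℂ)) = ((1 + 4 * h : ℝ) : ℂ) := by push_cast; ring
    rw [this, Complex.ofReal_re]
    positivity
  rw [gaussHypergeometric_eq_eulerIntegral _ hb hz, eulerIntegral]
  have h1 : ∫ t in (0 : ℝ)..1, ((t ^ (b - 1) : ℝ) : ℂ) *
      (1 - ((-4 * h : ℝ) : ℂ) * t) ^ (-(-1 / 2 : ℂ)) =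
      ((∫ t in (0 : ℝ)..1, t ^ (b - 1) * (1 + 4 * (h * t)) ^ (1 / 2 : ℝ) : ℝ) : ℂ) := by
    rw [← intervalIntegral.integral_ofReal]
    refine intervalIntegral.integral_congr_ae (Filter.Eventually.of_forall fun t ht => ?_)
    rw [Set.uIoc_of_le zero_le_one] at ht
    have h0 : 0 ≤ 1 + 4 * (h * t) := by have := mul_pos hh ht.1; linarith
    push_cast
    rw [Complex.ofReal_cpow h0]
    congr 1
    push_cast
    congr 1 <;> ring
  -- Substituting `s = h t` produces `h · h^(b-1) = h^b`.
  have h2 : ∫ s in (0 : ℝ)..h, s ^ (b - 1) * (1 + 4 * s) ^ (1 / 2 : ℝ) =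
      h ^ b * ∫ t in (0 : ℝ)..1, t ^ (b - 1) * (1 + 4 * (h * t)) ^ (1 / 2 : ℝ) := by
    have h3 := intervalIntegral.mul_integral_comp_mul_left (a := 0) (b := 1) (c := h)
      (f := fun s : ℝ => s ^ (b - 1) * (1 + 4 * s) ^ (1 / 2 : ℝ))
    rw [mul_zero, mul_one] at h3
    rw [← h3, ← intervalIntegral.integral_const_mul, ← intervalIntegral.integral_const_mul]
    refine intervalIntegral.integral_congr_ae (Filter.Eventually.of_forall fun t ht => ?_)
    rw [Set.uIoc_of_le zero_le_one] at ht
    rw [Real.mul_rpow hh.le ht.1.le, Real.rpow_sub_one hh.ne']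
    field_simp
  rw [h1, h2]
  push_cast
  ring

end SuperSpace

namespace SuperSpace

open MeasureTheory Set Function Filter

/-! ### Moments of mollifiers and their limits -/

theorem integrableOn_Ioi_rpow_mul {a : ℝ} (ha : -1 < a) {φ : ℝ → ℝ} (hφ : ContinuousOn φ (Ici 0))
    {R : ℝ} (hR0 : 0 ≤ R) (hR : ∀ s, R < s → φ s = 0) :
    IntegrableOn (fun s => s ^ a * φ s) (Ioi 0) := by
  have h : IntervalIntegrable (fun s => s ^ a * φ s) volume 0 R :=
    (intervalIntegral.intervalIntegrable_rpow' ha).mul_continuousOn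
      (hφ.mono (by rw [uIcc_of_le hR0]; exact Icc_subset_Ici_self))
  rw [intervalIntegrable_iff_integrableOn_Ioc_of_le hR0] at h
  refine h.of_forall_sdiff_eq_zero measurableSet_Ioi fun s hs => ?_
  rw [hR s (not_le.1 fun hle => hs.2 ⟨hs.1, hle⟩), mul_zero]

theorem setIntegral_Ioi_eq_intervalIntegral {f : ℝ → ℝ} {R : ℝ} (hR0 : 0 ≤ R)
    (hR : ∀ s, R < s → f s = 0) : ∫ s in Ioi (0 : ℝ), f s = ∫ s in (0 : ℝ)..R, f s := by
  rw [intervalIntegral.integral_of_le hR0]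
  refine setIntegral_eq_of_subset_of_forall_sdiff_eq_zero measurableSet_Ioi
    Ioc_subset_Ioi_self fun s hs => ?_
  exact hR s (not_le.1 fun hle => hs.2 ⟨hs.1, hle⟩)

/-- Dominated convergence: the tails are bounded by `1`, vanish beyond `h + 1` once the support lies
in `(-1, 1)`, and are eventually constant in `i` at each `s ≠ h`, equal to `1` below `h` and to `0`
above. -/
theorem IsDeltaSequence.tendsto_integral_mollifierTail_zero {ρ : ℕ → ℝ → ℝ}
    (hρ : IsDeltaSequence ρ) {a h : ℝ} (ha : -1 < a) (hh : 0 < h) {φ : ℝ → ℝ}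
    (hφ : ContinuousOn φ (Ici 0)) :
    Tendsto (fun i => ∫ s in Ioi (0 : ℝ), s ^ a * (φ s * mollifierTail (ρ i) 0 (s - h))) atTop
      (𝓝 (∫ s in (0 : ℝ)..h, s ^ a * φ s)) := by
  have hlim : ∫ s in (0 : ℝ)..h, s ^ a * φ s =
      ∫ s in Ioi (0 : ℝ), s ^ a * (φ s * (Iic h).indicator 1 s) := by
    rw [setIntegral_Ioi_eq_intervalIntegral hh.le fun s hs => by
      simp [indicator_of_notMem (show s ∉ Iic h from not_le.2 hs)]]
    refine intervalIntegral.integral_congr_ae (Eventually.of_forall fun s hs => ?_)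
    rw [uIoc_of_le hh.le] at hs
    simp [indicator_of_mem (show s ∈ Iic h from hs.2)]
  rw [hlim]
  have hφm : AEStronglyMeasurable φ (volume.restrict (Ioi 0)) :=
    (hφ.mono Ioi_subset_Ici_self).aestronglyMeasurable measurableSet_Ioi
  have hpm : AEStronglyMeasurable (fun s : ℝ => s ^ a) (volume.restrict (Ioi 0)) :=
    (by fun_prop : Measurable fun s : ℝ => s ^ a).aestronglyMeasurable
  refine tendsto_integral_filter_of_dominated_convergence
    (fun s => (Ioc 0 (h + 1)).indicator (fun s => |s ^ a * φ s|) s) ?_ ?_ ?_ ?_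
  · filter_upwards [hρ.support_subset 1 one_pos] with i hi
    have hc : Continuous fun s => mollifierTail (ρ i) 0 (s - h) :=
      (continuous_mollifierTail (hρ.smooth i) hi 0).comp (by fun_prop)
    exact hpm.mul (hφm.mul hc.aestronglyMeasurable)
  · filter_upwards [hρ.support_subset 1 one_pos] with i hi
    filter_upwards [ae_restrict_mem measurableSet_Ioi] with s hs
    by_cases hs1 : s ≤ h + 1
    · rw [indicator_of_mem (show s ∈ Ioc 0 (h + 1) from ⟨hs, hs1⟩), ← mul_assoc, norm_mul,
        Real.norm_eq_abs, Real.norm_eq_abs]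
      exact mul_le_of_le_one_right (abs_nonneg _)
        (abs_mollifierTail_zero_le (hρ.nonneg i) (hρ.integral_eq_one i) _)
    · rw [mollifierTail_eq_zero hi 0 (by linarith), mul_zero, mul_zero, norm_zero]
      exact indicator_nonneg (fun _ _ => abs_nonneg _) _
  · have h1 : IntervalIntegrable (fun s => s ^ a * φ s) volume 0 (h + 1) :=
      (intervalIntegral.intervalIntegrable_rpow' ha).mul_continuousOn
        (hφ.mono (by rw [uIcc_of_le (by linarith)]; exact Icc_subset_Ici_self))
    rw [intervalIntegrable_iff_integrableOn_Ioc_of_le (by linarith)] at h1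
    exact ((integrable_indicator_iff measurableSet_Ioc).2 h1.abs).integrableOn
  · have hne : ∀ᵐ s ∂(volume.restrict (Ioi (0 : ℝ))), s ≠ h :=
      ae_restrict_of_ae (Measure.ae_ne volume h)
    filter_upwards [hne] with s hs
    refine tendsto_const_nhds.congr' ?_
    have hpos : 0 < |s - h| := abs_pos.2 (sub_ne_zero.2 hs)
    filter_upwards [hρ.support_subset (|s - h| / 2) (by linarith)] with i hi
    rcases lt_or_gt_of_ne hs with hlt | hgt
    · rw [mollifierTail_zero_eq_one (hρ.integral_eq_one i) hi
        (by rw [abs_of_neg (by linarith)] at hpos ⊢; linarith),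
        indicator_of_mem (show s ∈ Iic h from hlt.le), Pi.one_apply]
    · rw [mollifierTail_eq_zero hi 0 (by rw [abs_of_pos (by linarith)] at hpos ⊢; linarith),
        indicator_of_notMem (show s ∉ Iic h from not_le.2 hgt)]

theorem integrable_mul_of_tsupport_subset_Ioi {ψ v : ℝ → ℝ} (hψ : ContinuousOn ψ (Ioi 0))
    (hv : Continuous v) (hvc : HasCompactSupport v) (hv0 : tsupport v ⊆ Ioi 0) :
    Integrable (fun s => ψ s * v s) := by
  rw [← integrableOn_iff_integrable_of_support_subset (s := tsupport v)
    fun s hs => subset_tsupport v (right_ne_zero_of_mul hs)]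
  exact ((hψ.mono hv0).mul hv.continuousOn).integrableOn_compact hvc

section

variable {ρ : ℝ → ℝ} {r h : ℝ}

theorem tsupport_iteratedDeriv_comp_sub (hr : support ρ ⊆ Ioo (-r) r) (k : ℕ) :
    tsupport (fun s => iteratedDeriv k ρ (s - h)) ⊆ Icc (h - r) (h + r) := by
  refine closure_minimal (fun u hu => ?_) isClosed_Icc
  by_contra hn
  refine hu (iteratedDeriv_eq_zero_of_support hr k fun hm => hn ⟨?_, ?_⟩)
  · linarith [hm.1]
  · linarith [hm.2]

theorem hasCompactSupport_iteratedDeriv_comp_sub (hr : support ρ ⊆ Ioo (-r) r) (k : ℕ) :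
    HasCompactSupport (fun s => iteratedDeriv k ρ (s - h)) :=
  isCompact_Icc.of_isClosed_subset (isClosed_tsupport _) (tsupport_iteratedDeriv_comp_sub hr k)

/-- As `r < h`, the shifted mollifier is supported in a compact part of `(0, ∞)`, so there are no
boundary terms and the behaviour of `ψ` at `0` is irrelevant. -/
theorem integral_mul_iteratedDeriv_succ (hs : ContDiff ℝ (⊤ : ℕ∞) ρ) (hr : support ρ ⊆ Ioo (-r) r)
    (hrh : r < h) (k : ℕ) {ψ : ℝ → ℝ} (hψ : ContDiffOn ℝ (⊤ : ℕ∞) ψ (Ioi 0)) :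
    ∫ s, ψ s * iteratedDeriv (k + 1) ρ (s - h) = -∫ s, deriv ψ s * iteratedDeriv k ρ (s - h) := by
  have hsub : ∀ k, tsupport (fun s => iteratedDeriv k ρ (s - h)) ⊆ Ioi 0 := fun k s hs' =>
    lt_of_lt_of_le (by linarith : (0 : ℝ) < h - r) (tsupport_iteratedDeriv_comp_sub hr k hs').1
  have hcont : ∀ k, Continuous fun s => iteratedDeriv k ρ (s - h) := fun k =>
    (contDiff_iteratedDeriv_of_smooth hs k).continuous.comp (by fun_prop)
  have hψ' : ContinuousOn (deriv ψ) (Ioi 0) :=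
    hψ.continuousOn_deriv_of_isOpen isOpen_Ioi (by simp)
  refine integral_mul_deriv_eq_deriv_mul_of_integrable
    (u := ψ) (v := fun s => iteratedDeriv k ρ (s - h))
    (u' := deriv ψ) (v' := fun s => iteratedDeriv (k + 1) ρ (s - h)) (fun s hs' => ?_)
    (fun s _ => ?_)
    (integrable_mul_of_tsupport_subset_Ioi hψ.continuousOn (hcont _)
      (hasCompactSupport_iteratedDeriv_comp_sub hr _) (hsub _))
    (integrable_mul_of_tsupport_subset_Ioi hψ' (hcont _)
      (hasCompactSupport_iteratedDeriv_comp_sub hr _) (hsub _))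
    (integrable_mul_of_tsupport_subset_Ioi hψ.continuousOn (hcont _)
      (hasCompactSupport_iteratedDeriv_comp_sub hr _) (hsub _))
  · exact ((hψ.differentiableOn (by simp)).differentiableAt
      (isOpen_Ioi.mem_nhds (hsub k hs'))).hasDerivAt
  · have h1 := ((contDiff_iteratedDeriv_of_smooth hs k).differentiable (by simp) (s - h)).hasDerivAt
    rw [← iteratedDeriv_succ] at h1
    exact h1.comp_sub_const s h

end

theorem IsDeltaSequence.tendsto_integral_mul {ρ : ℕ → ℝ → ℝ} (hρ : IsDeltaSequence ρ) {h : ℝ}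
    (hh : 0 < h) {ψ : ℝ → ℝ} (hψ : ContinuousOn ψ (Ioi 0)) :
    Tendsto (fun i => ∫ s, ψ s * ρ i (s - h)) atTop (𝓝 (ψ h)) := by
  rw [Metric.tendsto_nhds]
  intro ε hε
  obtain ⟨δ, hδ, hδψ⟩ := Metric.continuousAt_iff.1 (hψ.continuousAt (Ioi_mem_nhds hh)) (ε / 2)
    (by linarith)
  filter_upwards [hρ.support_subset (min δ (h / 2)) (lt_min hδ (by linarith))] with i hi
  have hcont : Continuous fun s => ρ i (s - h) := (hρ.smooth i).continuous.comp (by fun_prop)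
  have hcs : HasCompactSupport fun s => ρ i (s - h) := by
    simpa [iteratedDeriv_zero] using hasCompactSupport_iteratedDeriv_comp_sub (h := h) hi 0
  have hts : tsupport (fun s => ρ i (s - h)) ⊆ Ioi 0 := by
    have := tsupport_iteratedDeriv_comp_sub (h := h) hi 0
    simp only [iteratedDeriv_zero] at this
    intro s hs
    have h1 := (this hs).1
    have h2 := min_le_right δ (h / 2)
    exact lt_of_lt_of_le (by linarith : (0 : ℝ) < h / 2) (by linarith)
  have hint : Integrable fun s => ρ i (s - h) := hcont.integrable_of_hasCompactSupport hcs
  have hone : ∫ s, ρ i (s - h) = 1 := by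
    rw [integral_sub_right_eq_self (fun s => ρ i s) h]
    exact hρ.integral_eq_one i
  have hdiff : (∫ s, ψ s * ρ i (s - h)) - ψ h = ∫ s, (ψ s - ψ h) * ρ i (s - h) := by
    simp_rw [sub_mul]
    rw [integral_sub (integrable_mul_of_tsupport_subset_Ioi hψ hcont hcs hts) (hint.const_mul _),
      integral_const_mul, hone, mul_one]
  rw [Real.dist_eq, hdiff, ← Real.norm_eq_abs]
  refine lt_of_le_of_lt (norm_integral_le_of_norm_le (hint.const_mul (ε / 2))
    (Eventually.of_forall fun s => ?_)) ?_
  · rw [norm_mul, Real.norm_of_nonneg (hρ.nonneg i _)]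
    by_cases hz : ρ i (s - h) = 0
    · simp [hz]
    · refine mul_le_mul_of_nonneg_right ?_ (hρ.nonneg i _)
      have hm := hi hz
      have h2 := min_le_left δ (h / 2)
      have := hδψ (x := s) (by rw [Real.dist_eq, abs_lt]; constructor <;> linarith [hm.1, hm.2])
      rw [Real.dist_eq] at this
      exact this.le
  · rw [integral_const_mul, hone]
    linarith

/-- Each induction step moves one derivative onto `ψ`. The limit is fixed before `ρ`, hence common
to all mollifier sequences. -/
theorem exists_tendsto_integral_mul_iteratedDeriv {h : ℝ} (hh : 0 < h) (k : ℕ) {ψ : ℝ → ℝ}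
    (hψ : ContDiffOn ℝ (⊤ : ℕ∞) ψ (Ioi 0)) :
    ∃ L, ∀ ρ : ℕ → ℝ → ℝ, IsDeltaSequence ρ →
      Tendsto (fun i => ∫ s, ψ s * iteratedDeriv k (ρ i) (s - h)) atTop (𝓝 L) := by
  induction k generalizing ψ with
  | zero =>
    refine ⟨ψ h, fun ρ hρ => ?_⟩
    simpa only [iteratedDeriv_zero] using hρ.tendsto_integral_mul hh hψ.continuousOn
  | succ k ih =>
    obtain ⟨L, hL⟩ := ih (hψ.deriv_of_isOpen isOpen_Ioi (m := (⊤ : ℕ∞)) (by simp))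
    refine ⟨-L, fun ρ hρ => (hL ρ hρ).neg.congr' ?_⟩
    filter_upwards [hρ.support_subset (h / 2) (by linarith)] with i hi
    rw [integral_mul_iteratedDeriv_succ (hρ.smooth i) hi (by linarith) k hψ]

theorem exists_tendsto_integral_mollifierTail {a h : ℝ} (ha : -1 < a) (hh : 0 < h) (k : ℕ)
    {φ : ℝ → ℝ} (hφ : ContinuousOn φ (Ici 0)) (hφs : ContDiffOn ℝ (⊤ : ℕ∞) φ (Ioi 0)) :
    ∃ L, ∀ ρ : ℕ → ℝ → ℝ, IsDeltaSequence ρ →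
      Tendsto (fun i => ∫ s in Ioi (0 : ℝ), s ^ a * (φ s * mollifierTail (ρ i) k (s - h))) atTop
        (𝓝 L) := by
  cases k with
  | zero => exact ⟨_, fun ρ hρ => hρ.tendsto_integral_mollifierTail_zero ha hh hφ⟩
  | succ k =>
    have hpow : ContDiffOn ℝ (⊤ : ℕ∞) (fun s : ℝ => s ^ a) (Ioi 0) := fun s hs =>
      (Real.contDiffAt_rpow_const_of_ne (ne_of_gt hs)).contDiffWithinAt
    obtain ⟨L, hL⟩ := exists_tendsto_integral_mul_iteratedDeriv hh k (hpow.mul hφs).neg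
    refine ⟨L, fun ρ hρ => (hL ρ hρ).congr' ?_⟩
    filter_upwards [hρ.support_subset h hh] with i hi
    rw [← setIntegral_eq_integral_of_forall_compl_eq_zero (s := Ioi (0 : ℝ))]
    · refine integral_congr_ae (Eventually.of_forall fun s => ?_)
      simp only [mollifierTail]
      ring
    · intro s hs
      have hs : s ≤ 0 := not_lt.1 hs
      have h0 : iteratedDeriv k (ρ i) (s - h) = 0 := by
        rcases hs.lt_or_eq with hs | hs
        · exact iteratedDeriv_eq_zero_of_support hi k fun hm => by linarith [hm.1]
        -- At `s = 0` the argument is `-h`, an endpoint of the closed interval not excluded by the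
        -- support lemma; vanishing there follows by continuity from the left.
        · have hd : ∀ u < -h, iteratedDeriv k (ρ i) u = 0 := fun u hu =>
            iteratedDeriv_eq_zero_of_support hi k fun hm => by linarith [hm.1]
          have hc := (contDiff_iteratedDeriv_of_smooth (hρ.smooth i) k).continuous
          have hcl : Iic (-h) ⊆ {u | iteratedDeriv k (ρ i) u = 0} := by
            rw [← closure_Iio]
            exact closure_minimal hd (isClosed_eq hc continuous_const)
          exact hcl (by simp [hs])
      rw [h0, mul_zero]

/-! ### Integration by parts against powers -/

theorem integral_rpow_mul_deriv {a R : ℝ} (ha : 0 < a) (hR : 0 ≤ R) {u u' : ℝ → ℝ}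
    (hu : ∀ s, 0 ≤ s → HasDerivAt u (u' s) s) (hu' : ContinuousOn u' (Ici 0)) (huR : u R = 0) :
    ∫ s in (0 : ℝ)..R, s ^ a * u' s = -(a * ∫ s in (0 : ℝ)..R, s ^ (a - 1) * u s) := by
  have hsub : uIcc 0 R ⊆ Ici 0 := by rw [uIcc_of_le hR]; exact Icc_subset_Ici_self
  have h := intervalIntegral.integral_mul_deriv_eq_deriv_mul_of_hasDerivAt (a := 0) (b := R)
    (u := fun s : ℝ => s ^ a) (v := u) (u' := fun s => a * s ^ (a - 1)) (v' := u')
    (Real.continuous_rpow_const ha.le).continuousOn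
    (fun s hs => (hu s (hsub hs)).continuousAt.continuousWithinAt)
    (fun s hs => by
      rw [min_eq_left hR] at hs
      exact Real.hasDerivAt_rpow_const (Or.inl hs.1.ne'))
    (fun s hs => hu s (by rw [min_eq_left hR] at hs; exact hs.1.le))
    ((intervalIntegral.intervalIntegrable_rpow' (by linarith)).const_mul a)
    ((hu'.mono hsub).intervalIntegrable)
  rw [h, huR, Real.zero_rpow ha.ne', ← intervalIntegral.integral_const_mul]
  simp [mul_assoc]

/-- Repeated integration by parts, with the product of exponents `a (a-1) ⋯` recorded as a Gamma
quotient and cleared of denominators. The condition `k < a + 1` keeps every exponent before an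
integration by parts positive, which kills the boundary term at `0`. -/
theorem Gamma_mul_integral_rpow_mul_iterate {R : ℝ} (hR : 0 ≤ R) {V : ℕ → ℝ → ℝ}
    (hV : ∀ k s, 0 ≤ s → HasDerivAt (V k) (V (k + 1) s) s) (hVR : ∀ k, V k R = 0) (k : ℕ) {a : ℝ}
    (ha : (k : ℝ) < a + 1) :
    Real.Gamma (a + 1 - k) * ∫ s in (0 : ℝ)..R, s ^ a * V k s =
      (-1) ^ k * Real.Gamma (a + 1) * ∫ s in (0 : ℝ)..R, s ^ (a - k) * V 0 s := by
  induction k generalizing a with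
  | zero => simp
  | succ k ih =>
    push_cast at ha
    have ha0 : 0 < a := by
      have : (0 : ℝ) ≤ k := k.cast_nonneg
      linarith
    have hc : ContinuousOn (V (k + 1)) (Ici 0) := fun s hs =>
      (hV (k + 1) s hs).continuousAt.continuousWithinAt
    have h := ih (a := a - 1) (by linarith)
    rw [sub_add_cancel] at h
    rw [integral_rpow_mul_deriv ha0 hR (hV k) hc (hVR k), Real.Gamma_add_one ha0.ne']
    have e1 : a + 1 - ((k + 1 : ℕ) : ℝ) = a - k := by push_cast; ring
    have e2 : a - ((k + 1 : ℕ) : ℝ) = a - 1 - k := by push_cast; ring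
    rw [e1, e2, pow_succ]
    linear_combination (-a) * h

/-- The Leibniz expression for the `k`-th derivative of a product. -/
noncomputable def leibnizSum (P Q : ℕ → ℝ → ℝ) (k : ℕ) (s : ℝ) : ℝ :=
  ∑ j ∈ Finset.range (k + 1), (k.choose j : ℝ) * (P j s * Q (k - j) s)

theorem hasDerivAt_leibnizSum {P Q : ℕ → ℝ → ℝ} {s : ℝ}
    (hP : ∀ k, HasDerivAt (P k) (P (k + 1) s) s) (hQ : ∀ k, HasDerivAt (Q k) (Q (k + 1) s) s)
    (k : ℕ) : HasDerivAt (leibnizSum P Q k) (leibnizSum P Q (k + 1) s) s := by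
  have h : HasDerivAt (leibnizSum P Q k) (∑ j ∈ Finset.range (k + 1), (k.choose j : ℝ) *
      (P (j + 1) s * Q (k - j) s + P j s * Q (k - j + 1) s)) s :=
    HasDerivAt.fun_sum fun j _ => ((hP j).mul (hQ (k - j))).const_mul _
  convert! h using 1
  rw [leibnizSum, Finset.sum_choose_succ_mul (fun i j => P i s * Q j s) k,
    ← Finset.sum_add_distrib]
  refine Finset.sum_congr rfl fun j hj => ?_
  rw [Nat.sub_add_comm (Nat.lt_succ_iff.1 (Finset.mem_range.1 hj))]
  ring

theorem hasDerivAt_densityDeriv (k : ℕ) {s : ℝ} (hs : 0 ≤ s) :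
    HasDerivAt (densityDeriv k) (densityDeriv (k + 1) s) s := by
  have h1 : HasDerivAt (fun s : ℝ => 1 + 4 * s) 4 s := by
    simpa using ((hasDerivAt_id s).const_mul 4).const_add 1
  have h2 := (h1.rpow_const (p := (1 / 2 : ℝ) - k) (Or.inl (by positivity))).const_mul
    ((-1) ^ k * (ascPochhammer ℝ k).eval (-(1 / 2)) * 4 ^ k)
  convert! h2 using 1
  rw [densityDeriv, ascPochhammer_succ_eval,
    show (1 / 2 : ℝ) - ((k + 1 : ℕ) : ℝ) = 1 / 2 - k - 1 by push_cast; ring]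
  ring

theorem continuousOn_densityDeriv (k : ℕ) : ContinuousOn (densityDeriv k) (Ici 0) := fun _ hs =>
  (hasDerivAt_densityDeriv k hs).continuousAt.continuousWithinAt

theorem measurable_densityDeriv (k : ℕ) : Measurable (densityDeriv k) := by
  unfold densityDeriv
  fun_prop

theorem contDiffOn_densityDeriv (k : ℕ) : ContDiffOn ℝ (⊤ : ℕ∞) (densityDeriv k) (Ioi 0) := by
  intro s hs
  have hs : 0 < s := hs
  refine ContDiffAt.contDiffWithinAt (contDiffAt_const.mul ?_)
  exact ContDiffAt.rpow_const_of_ne (by fun_prop) (by positivity)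

/-- The binomial sum of the one-dimensional integrals is an integral against `s ^ (a - n)`. -/
theorem sum_choose_mul_integral_mollifierTail {ρ : ℝ → ℝ} (hs : ContDiff ℝ (⊤ : ℕ∞) ρ)
    (hr : support ρ ⊆ Ioo (-1) 1) {h a : ℝ} (hh : 0 < h) (n : ℕ) (ha : (n : ℝ) < a + 1) :
    Real.Gamma (a + 1 - n) * ∑ j ∈ Finset.range (n + 1), (n.choose j : ℝ) *
      ∫ s in Ioi (0 : ℝ), s ^ a * (densityDeriv (n - j) s * mollifierTail ρ j (s - h)) =
    (-1) ^ n * Real.Gamma (a + 1) *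
      ∫ s in Ioi (0 : ℝ), s ^ (a - n) * (densityDeriv 0 s * mollifierTail ρ 0 (s - h)) := by
  have ha1 : -1 < a := by
    have : (0 : ℝ) ≤ n := n.cast_nonneg
    linarith
  set P : ℕ → ℝ → ℝ := fun k s => mollifierTail ρ k (s - h) with hP
  have hP0 : ∀ k s, h + 1 < s → P k s = 0 := fun k s hs' =>
    mollifierTail_eq_zero hr k (by linarith)
  have hPc : ∀ k, Continuous (P k) := fun k =>
    (continuous_mollifierTail hs hr k).comp (by fun_prop)
  have hV0 : ∀ k s, h + 1 < s → leibnizSum P densityDeriv k s = 0 := fun k s hs' =>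
    Finset.sum_eq_zero fun j _ => by rw [hP0 j s hs', zero_mul, mul_zero]
  -- The sum over `j` thus becomes the `n`-th derivative of the single product `P 0 * densityDeriv
  -- 0`.
  have hV : ∀ k s, 0 ≤ s → HasDerivAt (leibnizSum P densityDeriv k)
      (leibnizSum P densityDeriv (k + 1) s) s := fun k s hs' =>
    hasDerivAt_leibnizSum (fun j => (hasDerivAt_mollifierTail hs hr j (s - h)).comp_sub_const s h)
      (fun j => hasDerivAt_densityDeriv j hs') k
  -- All functions vanish strictly beyond `h + 1`, so they vanish at the endpoint `h + 2`.
  have hR : (0 : ℝ) ≤ h + 2 := by linarith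
  have key := Gamma_mul_integral_rpow_mul_iterate hR hV (fun k => hV0 k _ (by linarith)) n ha
  rw [← setIntegral_Ioi_eq_intervalIntegral hR fun s hs' => by
      rw [hV0 n s (by linarith), mul_zero],
    ← setIntegral_Ioi_eq_intervalIntegral hR fun s hs' => by
      rw [hV0 0 s (by linarith), mul_zero]] at key
  have hsum : ∫ s in Ioi (0 : ℝ), s ^ a * leibnizSum P densityDeriv n s =
      ∑ j ∈ Finset.range (n + 1), (n.choose j : ℝ) *
        ∫ s in Ioi (0 : ℝ), s ^ a * (densityDeriv (n - j) s * P j s) := by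
    simp_rw [← integral_const_mul]
    rw [← integral_finsetSum]
    · refine integral_congr_ae (Eventually.of_forall fun s => ?_)
      simp only [leibnizSum, Finset.mul_sum]
      refine Finset.sum_congr rfl fun j _ => ?_
      ring
    · intro j _
      refine Integrable.const_mul ?_ _
      exact integrableOn_Ioi_rpow_mul ha1
        ((continuousOn_densityDeriv _).mul (hPc j).continuousOn) hR
        fun s hs' => by rw [hP0 j s (by linarith), mul_zero]
  rw [hsum] at key
  rw [key]
  congr 1
  refine integral_congr_ae (Eventually.of_forall fun s => ?_)
  simp [leibnizSum, hP, mul_comm]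

/-! ### The area of the super-paraboloid -/

variable {d n : ℕ} {h : ℝ}

theorem integral_paraboloid_delta (hd : 0 < d) {ρ : ℝ → ℝ} (hs : ContDiff ℝ (⊤ : ℕ∞) ρ)
    (hr : support ρ ⊆ Ioo (-1) 1) {j : ℕ} (hj : j ≤ n) :
    ∫ x, iteratedDeriv j ρ (body (paraboloidPhase d n x)) * heaviside (-heightPhase d h x) *
      berezin (nilpotentPart (paraboloidPhase d n x) ^ j *
        ((superGradient (paraboloidPhase d n) x).abs * 1)) =
    (-1) ^ n * (n.factorial : ℝ) / Real.pi ^ n * ((n - j).factorial : ℝ)⁻¹ *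
      (Real.pi ^ ((d : ℝ) / 2) / Real.Gamma ((d : ℝ) / 2)) *
        ∫ s in Ioi (0 : ℝ), s ^ ((d : ℝ) / 2 - 1) *
          (densityDeriv (n - j) s * mollifierTail ρ j (s - h)) := by
  simp_rw [berezin_density hj, body_paraboloidPhase]
  rw [mul_assoc _ (Real.pi ^ ((d : ℝ) / 2) / Real.Gamma ((d : ℝ) / 2)),
    ← integral_delta_eq hd hs hr j h (measurable_densityDeriv _) (continuousOn_densityDeriv _),
    ← integral_const_mul]
  refine integral_congr_ae (Eventually.of_forall fun x => ?_)
  simp only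
  ring

/-- The surface area of the super-paraboloid as a one-dimensional integral, for `d > 2 n`. -/
theorem hasSurfaceIntegral_paraboloid (hh : 0 < h) (hdn : 2 * n < d) :
    HasSurfaceIntegral (paraboloidPhase d n) (heightPhase d h) (fun _ => 1)
      (Real.pi ^ ((d : ℝ) / 2 - n) / Real.Gamma ((d : ℝ) / 2 - n) *
        ∫ s in (0 : ℝ)..h, s ^ ((d : ℝ) / 2 - n - 1) * (1 + 4 * s) ^ (1 / 2 : ℝ)) := by
  have hd : 0 < d := by omega
  have hdn' : 2 * (n : ℝ) < d := by exact_mod_cast hdn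
  have hd' : (0 : ℝ) < d := by exact_mod_cast hd
  set a : ℝ := (d : ℝ) / 2 - 1 with ha
  have ha1 : -1 < a := by rw [ha]; linarith
  have han : (n : ℝ) < a + 1 := by rw [ha]; linarith
  -- The individual limits are only known to exist. For `j > n` the subtraction truncates, but those
  -- indices are not used.
  choose J hJ using fun j : ℕ => exists_tendsto_integral_mollifierTail ha1 hh j
    (continuousOn_densityDeriv (n - j)) (contDiffOn_densityDeriv (n - j))
  set c : ℝ := Real.pi ^ ((d : ℝ) / 2) / Real.Gamma ((d : ℝ) / 2) with hc
  refine ⟨fun j => (-1) ^ n * (n.factorial : ℝ) / Real.pi ^ n * ((n - j.val).factorial : ℝ)⁻¹ *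
    c * J j, fun j ρ hρ => ?_, ?_⟩
  · refine ((hJ j ρ hρ).const_mul _).congr' ?_
    filter_upwards [hρ.support_subset 1 one_pos] with i hi
    exact (integral_paraboloid_delta hd (hρ.smooth i) hi (Nat.lt_succ_iff.1 j.isLt)).symm
  · obtain ⟨ρ, hρ⟩ := exists_isDeltaSequence
    -- The combined value comes from passing to the limit in an identity valid for each sufficiently
    -- concentrated mollifier.
    have hsum : Real.Gamma (a + 1 - n) *
        ∑ j ∈ Finset.range (n + 1), (n.choose j : ℝ) * J j =
        (-1) ^ n * Real.Gamma (a + 1) *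
          ∫ s in (0 : ℝ)..h, s ^ (a - n) * densityDeriv 0 s := by
      refine tendsto_nhds_unique
        ((tendsto_finsetSum _ fun j _ => (hJ j ρ hρ).const_mul (n.choose j : ℝ)).const_mul
          (Real.Gamma (a + 1 - n))) ?_
      refine ((hρ.tendsto_integral_mollifierTail_zero (a := a - n) (by linarith) hh
        (continuousOn_densityDeriv 0)).const_mul ((-1) ^ n * Real.Gamma (a + 1))).congr' ?_
      filter_upwards [hρ.support_subset 1 one_pos] with i hi
      exact (sum_choose_mul_integral_mollifierTail (hρ.smooth i) hi hh n han).symm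
    have hG : Real.Gamma (a + 1 - n) ≠ 0 := (Real.Gamma_pos_of_pos (by linarith)).ne'
    have hG' : Real.Gamma (a + 1) ≠ 0 := (Real.Gamma_pos_of_pos (by linarith)).ne'
    have hterm : ∑ j : Fin (n + 1), (-1) ^ n * (n.factorial : ℝ) / Real.pi ^ n *
        ((n - j.val).factorial : ℝ)⁻¹ * c * J j / (j.val.factorial : ℝ) =
        (-1) ^ n / Real.pi ^ n * c * ∑ j ∈ Finset.range (n + 1), (n.choose j : ℝ) * J j := by
      rw [Finset.sum_range, Finset.mul_sum]
      refine Finset.sum_congr rfl fun j _ => ?_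
      rw [Nat.cast_choose ℝ (Nat.lt_succ_iff.1 j.isLt)]
      field_simp
    have hint : ∫ s in (0 : ℝ)..h, s ^ (a - n) * densityDeriv 0 s =
        ∫ s in (0 : ℝ)..h, s ^ ((d : ℝ) / 2 - n - 1) * (1 + 4 * s) ^ (1 / 2 : ℝ) := by
      refine intervalIntegral.integral_congr fun s _ => ?_
      simp [densityDeriv, ha, sub_right_comm]
    have hS : ∑ j ∈ Finset.range (n + 1), (n.choose j : ℝ) * J j =
        (-1) ^ n * Real.Gamma (a + 1) / Real.Gamma (a + 1 - n) *
          ∫ s in (0 : ℝ)..h, s ^ (a - n) * densityDeriv 0 s := by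
      field_simp
      linear_combination hsum
    have e1 : a + 1 = (d : ℝ) / 2 := by rw [ha]; ring
    rw [hterm, hS, hint, hc, Real.rpow_sub Real.pi_pos, Real.rpow_natCast, ← e1]
    -- One sign `(-1)^n` comes from the Berezin integral, the other from the integrations by parts.
    have hsq : ((-1 : ℝ) ^ n) * (-1) ^ n = 1 := by rw [← mul_pow]; simp
    field_simp
    linear_combination (-∫ s in (0 : ℝ)..h, s ^ (a + 1 - n - 1) * (1 + 4 * s) ^ (1 / 2 : ℝ)) * hsq

/-- The value selected by choice in `surfaceIntegral` is forced, since limits along one concrete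
mollifier sequence are unique. -/
theorem paraboloidArea_eq (hh : 0 < h) (hdn : 2 * n < d) :
    paraboloidArea d n h = Real.pi ^ ((d : ℝ) / 2 - n) / Real.Gamma ((d : ℝ) / 2 - n) *
      ∫ s in (0 : ℝ)..h, s ^ ((d : ℝ) / 2 - n - 1) * (1 + 4 * s) ^ (1 / 2 : ℝ) := by
  have hI := hasSurfaceIntegral_paraboloid hh hdn
  have hex : ∃ I, HasSurfaceIntegral (paraboloidPhase d n) (heightPhase d h) (fun _ => 1) I :=
    ⟨_, hI⟩
  rw [paraboloidArea, surfaceIntegral, dif_pos hex]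
  exact hex.choose_spec.unique hI

end SuperSpace

theorem mainTheorem9 (d n : ℕ) (h M : ℝ) (hh : 0 < h)
    (hMdef : M = SuperSpace.superdimension (d + 1) n) (hM : 1 < M) :
    (∃ A : ℝ, SuperSpace.HasSurfaceIntegral (SuperSpace.paraboloidPhase d n)
      (SuperSpace.heightPhase d h) (fun _ => 1) A) ∧
    ((SuperSpace.paraboloidArea d n h : ℝ) : ℂ) =
      ((Real.pi ^ ((M - 1) / 2) / Real.Gamma ((M + 1) / 2) * h ^ ((M - 1) / 2) : ℝ) : ℂ) *
        SuperSpace.gaussHypergeometric (-1 / 2) (((M - 1) / 2 : ℝ) : ℂ) (((M + 1) / 2 : ℝ) : ℂ)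
          ((-4 * h : ℝ) : ℂ) := by
  have hM' : (M - 1) / 2 = (d : ℝ) / 2 - n := by
    rw [hMdef, SuperSpace.superdimension]
    push_cast
    ring
  have hb : 0 < (M - 1) / 2 := by linarith
  -- The condition `M > 1` is exactly `d > 2 n`.
  have hdn : 2 * n < d := by
    have h1 : 2 * (n : ℝ) < d := by linarith
    exact_mod_cast h1
  refine ⟨⟨_, SuperSpace.hasSurfaceIntegral_paraboloid hh hdn⟩, ?_⟩
  -- With `b = (M - 1) / 2`, the prefactor `b` of Euler's integral cancels against `Γ(b + 1) = b
  -- Γ(b)`.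
  rw [SuperSpace.paraboloidArea_eq hh hdn, ← hM', show (M + 1) / 2 = (M - 1) / 2 + 1 by ring,
    Complex.ofReal_mul (_ / _) (h ^ _), mul_assoc, SuperSpace.rpow_mul_gaussHypergeometric hb hh,
    ← Complex.ofReal_mul, Real.Gamma_add_one hb.ne']
  congr 1
  have hG : Real.Gamma ((M - 1) / 2) ≠ 0 := (Real.Gamma_pos_of_pos hb).ne'
  have hM1 : M - 1 ≠ 0 := (sub_pos.2 hM).ne'
  field_simp
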